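/- Let $S$ be a set of $n\ge 3$ points in the plane in general position (no three points are collinear). A plane path of $S$ is a path that visits every point of $S$ exactly once and is drawn with non-crossing straight line segments; two plane paths are identified if they consist of the same segments. The flip graph of $S$ is the graph whose vertices are the plane paths of $S$, two of them being adjacent if the symmetric difference of their sets of segments consists of exactly two segments. Theorem 1. Let $n\ge 3$, let $C$ be a set of $n-1$ points in the plane in convex position, and let $\xi$ be a point outside the convex hull of $C$ such that $S=C\cup\{\xi\}$ is in general position. Then the following holds. (a) The flip graph of $S$ is connected and its diameter is at most $2n$. (b) The subgraph of the flip graph of $S$ induced by the plane paths in which $\xi$ has degree $1$ is connected and, if $n\ge 5$, its diameter is at most $4n-15$. (c) The subgraph of the flip graph of $S$ induced by the plane paths in which $\xi$ has degree $2$ is connected and its diameter is at most $2n$. -/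

import Mathlib

/-- The Euclidean plane. -/
abbrev Plane : Type := EuclideanSpace ℝ (Fin 2)

/-- A set of points of the plane is in general position if no three of its points are collinear. -/
def InGeneralPosition (S : Set Plane) : Prop :=
  ∀ a ∈ S, ∀ b ∈ S, ∀ c ∈ S, a ≠ b → a ≠ c → b ≠ c → ¬ Collinear ℝ ({a, b, c} : Set Plane)

/-- A set of points of the plane is in convex position if none of its points lies in the convex
hull of the other ones. -/
def InConvexPosition (C : Set Plane) : Prop :=
  ConvexIndependent ℝ ((↑) : C → Plane)

/-- A graph with vertex set `S` is a spanning path of `S` if it is isomorphic to a path graph. -/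
def IsSpanningPath {S : Set Plane} (G : SimpleGraph S) : Prop :=
  ∃ m : ℕ, Nonempty (SimpleGraph.pathGraph m ≃g G)

/-- A graph on points of the plane is drawn without crossings by straight line segments: two
different segments meet at most in a common endpoint. -/
def IsPlane {S : Set Plane} (G : SimpleGraph S) : Prop :=
  ∀ a b c d : S, G.Adj a b → G.Adj c d → s(a, b) ≠ s(c, d) →
    segment ℝ (a : Plane) b ∩ segment ℝ (c : Plane) d ⊆
      ({(a : Plane), (b : Plane)} ∩ {(c : Plane), (d : Plane)} : Set Plane)

/-- The plane (spanning) paths of a point set `S`. -/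
def PlanePath (S : Set Plane) : Type :=
  {G : SimpleGraph S // IsSpanningPath G ∧ IsPlane G}

/-- The flip graph of `S`: its vertices are the plane paths of `S`, and two of them are adjacent
if the symmetric difference of their sets of segments consists of exactly two segments. -/
def flipGraph (S : Set Plane) : SimpleGraph (PlanePath S) where
  Adj P Q := (symmDiff P.1.edgeSet Q.1.edgeSet).ncard = 2
  symm := ⟨fun P Q h => by rwa [symmDiff_comm]⟩
  loopless := ⟨fun P h => by simp at h⟩

/-- The plane paths of `S` in which the point `x` has degree `k`. -/
def pathsWithDegree (S : Set Plane) (x : S) (k : ℕ) : Set (PlanePath S) :=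
  {P | (P.1.neighborSet x).ncard = k}

/-!
Once its start is fixed, a plane path on points in convex position is a zigzag: at every step it
continues with the first or the last of the hull vertices that are left over. Straightening a
zigzag from its far end, by reversing one suffix per vertex at most, takes it to the boundary of the
hull. This moves only the part of the path beyond `ξ` and its first neighbour, so that the segments
at `ξ` stay in place.

If `ξ` is an inner vertex, then it splits the path into two zigzags through complementary parts of
`C`. Once both are straightened, a bounded number of flips leads to the boundary of the hull with
a detour to `ξ`; the flips saved while straightening pay for these, so that `n - 2` flips suffice.
Two detours are at most `4` flips apart, which gives the diameter `2 (n - 2) + 4 = 2 n`. Paths that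
end in `ξ` are straightened and reach a detour with one further flip.

If `ξ` has to remain an end, the only flips that change its neighbour reverse all of the path
behind `ξ`. Hence two paths with different neighbours `c` and `c'` of `ξ` are led to a path from
`c` to `c'` and to its reversal; together with the pivot this takes at most `2 n - 5` flips.
-/

namespace PlanePaths

section Lists

variable {α : Type*}

/-- `a` and `b` are consecutive entries of the list, in this order. -/
def Consec (a b : α) (l : List α) : Prop := [a, b] <:+: l

/-- `a` and `b` are neighbouring entries of the list, in either order: `ab` is a segment of the
polygonal path through `l`. -/
def Linked (a b : α) (l : List α) : Prop := Consec a b l ∨ Consec b a l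

lemma Linked.symm {a b : α} {l : List α} (h : Linked a b l) : Linked b a l := Or.symm h

lemma not_consec_nil (a b : α) : ¬ Consec a b [] := by simp [Consec]

lemma consec_cons {a b x : α} {t : List α} :
    Consec a b (x :: t) ↔ (a = x ∧ t.head? = some b) ∨ Consec a b t := by
  rcases t with _ | ⟨y, t⟩ <;>
    simp [Consec, List.infix_cons_iff, List.cons_prefix_cons, eq_comm (a := b)]

lemma consec_append {a b : α} {l₁ l₂ : List α} :
    Consec a b (l₁ ++ l₂) ↔ Consec a b l₁ ∨ Consec a b l₂ ∨
      (l₁.getLast? = some a ∧ l₂.head? = some b) := by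
  induction l₁ with
  | nil => simp [not_consec_nil]
  | cons x t ih =>
    rw [List.cons_append, consec_cons, consec_cons, ih]
    rcases t with _ | ⟨y, t⟩
    · simp only [not_consec_nil, List.nil_append, List.head?_nil, List.getLast?_nil,
        List.getLast?_singleton, Option.some.injEq, eq_comm (a := x)]
      tauto
    · simp only [List.cons_append, List.head?_cons, List.getLast?_cons_cons]
      tauto

lemma Consec.mem {a b : α} {l : List α} (h : Consec a b l) : a ∈ l ∧ b ∈ l :=
  ⟨h.subset (by simp), h.subset (by simp)⟩

lemma Consec.ne {a b : α} {l : List α} (h : Consec a b l) (hl : l.Nodup) : a ≠ b := by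
  simpa using h.sublist.nodup hl

lemma consec_reverse {a b : α} {l : List α} : Consec a b l.reverse ↔ Consec b a l := by
  rw [Consec, Consec, ← List.reverse_infix, List.reverse_reverse]
  rfl

lemma linked_reverse {a b : α} {l : List α} : Linked a b l.reverse ↔ Linked a b l := by
  rw [Linked, Linked, consec_reverse, consec_reverse, or_comm]

lemma linked_append {a b : α} {l₁ l₂ : List α} :
    Linked a b (l₁ ++ l₂) ↔ Linked a b l₁ ∨ Linked a b l₂ ∨
      (l₁.getLast? = some a ∧ l₂.head? = some b) ∨ (l₁.getLast? = some b ∧ l₂.head? = some a) := by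
  simp only [Linked, consec_append]
  tauto

lemma consec_iff_getElem? {a b : α} {l : List α} :
    Consec a b l ↔ ∃ i, l[i]? = some a ∧ l[i + 1]? = some b := by
  rw [Consec, List.infix_iff_getElem?]
  constructor
  · rintro ⟨k, -, h⟩
    exact ⟨k, by simpa using h 0 (by simp), by simpa [add_comm] using h 1 (by simp)⟩
  · rintro ⟨k, ha, hb⟩
    have hk : k + 1 < l.length := (List.getElem?_eq_some_iff.1 hb).1
    refine ⟨k, by simp only [List.length_cons, List.length_nil]; lia, fun i hi => ?_⟩
    simp only [List.length_cons, List.length_nil] at hi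
    interval_cases i
    · simpa using ha
    · simpa [add_comm] using hb

lemma consec_getElem_iff {l : List α} (hl : l.Nodup) {i j : ℕ} (hi : i < l.length)
    (hj : j < l.length) : Consec l[i] l[j] l ↔ i + 1 = j := by
  simp only [consec_iff_getElem?, List.getElem?_eq_some_iff]
  constructor
  · rintro ⟨k, ⟨_, h₁⟩, _, h₂⟩
    rw [← hl.getElem_inj_iff.1 h₁, hl.getElem_inj_iff.1 h₂]
  · rintro rfl
    exact ⟨i, ⟨hi, rfl⟩, hj, rfl⟩

lemma Linked.mem {a b : α} {l : List α} (h : Linked a b l) : a ∈ l ∧ b ∈ l :=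
  h.elim Consec.mem fun h => h.mem.symm

lemma Linked.ne {a b : α} {l : List α} (h : Linked a b l) (hl : l.Nodup) : a ≠ b :=
  h.elim (fun h => h.ne hl) fun h => (h.ne hl).symm

lemma exists_linked_of_mem {l : List α} (P : α → Prop) {x y : α} (hx : x ∈ l) (hy : y ∈ l)
    (hPx : P x) (hPy : ¬ P y) : ∃ a b, Linked a b l ∧ P a ∧ ¬ P b := by
  by_contra! h
  have hchain : l.IsChain (fun a b => P a ↔ P b) :=
    List.isChain_iff_forall_rel_of_append_cons_cons.2 fun a b l₁ l₂ hl =>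
      have hab : Consec a b l := ⟨l₁, l₂, by simp [hl]⟩
      ⟨h a b (Or.inl hab), h b a (Or.inr hab)⟩
  have : Trans (fun a b => P a ↔ P b) (fun a b => P a ↔ P b) (fun a b => P a ↔ P b) :=
    ⟨Iff.trans⟩
  have : Std.Symm (fun a b => P a ↔ P b) := ⟨fun _ _ => Iff.symm⟩
  exact hPy (((List.isChain_iff_pairwise.1 hchain).forall_of_forall (R := fun a b => P a ↔ P b)
    (fun _ _ => Iff.rfl) hx hy).1 hPx)

lemma pair_sublist_or {l : List α} {x y : α} (hx : x ∈ l) (hy : y ∈ l) (hxy : x ≠ y) :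
    [x, y].Sublist l ∨ [y, x].Sublist l := by
  obtain ⟨s, t, rfl⟩ := List.append_of_mem hx
  rcases List.mem_append.1 hy with h | h
  · exact .inr (.append (List.singleton_sublist.2 h) ((List.nil_sublist t).cons_cons x))
  · have hyt := (List.mem_cons.1 h).resolve_left hxy.symm
    exact .inl ((List.singleton_sublist.2 hyt).cons_cons x |>.trans (List.sublist_append_right s _))

lemma exists_append_of_pairwise_imp (P : α → Prop) (l : List α)
    (h : l.Pairwise (fun x y => P x → P y)) :
    ∃ R L, l = R ++ L ∧ (∀ x ∈ R, ¬ P x) ∧ ∀ x ∈ L, P x := by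
  induction l with
  | nil => exact ⟨[], [], by simp⟩
  | cons a t ih =>
    rw [List.pairwise_cons] at h
    by_cases ha : P a
    · exact ⟨[], a :: t, rfl, by simp, List.forall_mem_cons.2 ⟨ha, fun x hx => h.1 x hx ha⟩⟩
    · obtain ⟨R, L, rfl, hR, hL⟩ := ih h.2
      exact ⟨a :: R, L, rfl, List.forall_mem_cons.2 ⟨ha, hR⟩, hL⟩

lemma exists_interval (P : α → Prop) (l : List α)
    (h : ∀ x y z, [x, y, z].Sublist l → P x → P z → P y) :
    ∃ A B C, l = A ++ (B ++ C) ∧ (∀ x ∈ A, ¬ P x) ∧ (∀ x ∈ B, P x) ∧ ∀ x ∈ C, ¬ P x := by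
  induction l with
  | nil => exact ⟨[], [], [], by simp⟩
  | cons a t ih =>
    obtain ⟨A, B, C, rfl, hA, hB, hC⟩ := ih fun x y z hs => h x y z (hs.cons a)
    by_cases ha : P a
    · rcases B with _ | ⟨b, B⟩
      · exact ⟨[], [a], A ++ C, by simp, by simp, by simpa using ha,
          List.forall_mem_append.2 ⟨hA, hC⟩⟩
      · rcases A with _ | ⟨p, A⟩
        · exact ⟨[], a :: b :: B, C, rfl, by simp, List.forall_mem_cons.2 ⟨ha, hB⟩, hC⟩
        · exact absurd (h a p b (by simp) ha (hB b List.mem_cons_self))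
            (hA p List.mem_cons_self)
    · exact ⟨a :: A, B, C, rfl, List.forall_mem_cons.2 ⟨ha, hA⟩, hB, hC⟩

lemma exists_pairwise_list (s : Finset α) (r : α → α → Prop)
    (htot : ∀ x ∈ s, ∀ y ∈ s, x ≠ y → r x y ∨ r y x)
    (htrans : ∀ x ∈ s, ∀ y ∈ s, ∀ z ∈ s, r x y → r y z → r x z) :
    ∃ l : List α, l.Nodup ∧ (∀ x, x ∈ l ↔ x ∈ s) ∧ l.Pairwise r := by
  classical
  let r' : s → s → Prop := fun x y => x = y ∨ r x y
  have : Std.Total r' := ⟨fun x y => by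
    by_cases hxy : x = y
    · exact .inl (.inl hxy)
    · exact (htot x x.2 y y.2 (Subtype.coe_ne_coe.2 hxy)).imp .inr .inr⟩
  have : IsTrans s r' := ⟨by
    rintro x y z (rfl | hxy) (rfl | hyz)
    · exact .inl rfl
    · exact .inr hyz
    · exact .inr hxy
    · exact .inr (htrans x x.2 y y.2 z z.2 hxy hyz)⟩
  let l := s.attach.toList.insertionSort r'
  have hl : l.Nodup := (List.perm_insertionSort r' _).nodup_iff.2 s.attach.nodup_toList
  refine ⟨l.map (↑), hl.map Subtype.val_injective, fun x => by simp [l], ?_⟩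
  rw [List.pairwise_map]
  exact ((List.pairwise_insertionSort r' _).and hl).imp fun h => h.1.resolve_left h.2

variable {A B R L G H : List α}

lemma perm_and_perm_of_subset (h : (A ++ B).Perm (R ++ L)) (hn : (A ++ B).Nodup) (hA : A ⊆ R)
    (hB : B ⊆ L) : A.Perm R ∧ B.Perm L := by
  have hlen := h.length_eq
  simp only [List.length_append] at hlen
  have hA' := List.subperm_of_subset hn.of_append_left hA
  have hB' := List.subperm_of_subset hn.of_append_right hB
  have := hA'.length_le
  have := hB'.length_le
  exact ⟨hA'.perm_of_length_le (by lia), hB'.perm_of_length_le (by lia)⟩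

lemma exists_linked_across {u v b b' : α} (hn : (u :: G ++ v :: H).Nodup)
    (hB : B ⊆ u :: G ++ v :: H) (hu : u ∉ B) (hv : v ∉ B) (hb : b ∈ B) (hbG : b ∈ G)
    (hb' : b' ∈ B) (hbH : b' ∈ H) : ∃ c d, Linked c d B ∧ c ∈ G ∧ d ∈ H := by
  have hdisj : b' ∉ G := fun hbG' =>
    (List.nodup_append.1 hn).2.2 b' (by simp [hbG']) b' (by simp [hbH]) rfl
  obtain ⟨c, d, hcd, hcG, hdG⟩ := exists_linked_of_mem (· ∈ G) hb hb' hbG hdisj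
  refine ⟨c, d, hcd, hcG, ?_⟩
  have hdu : d ≠ u := fun e => hu (e ▸ hcd.mem.2)
  have hdv : d ≠ v := fun e => hv (e ▸ hcd.mem.2)
  simpa [hdu, hdv, hdG] using hB hcd.mem.2

lemma exists_append_of_sublist {x y z : α} {l : List α} (h : [x, y, z].Sublist l) :
    ∃ G H, l = G ++ y :: H ∧ x ∈ G ∧ z ∈ H := by
  obtain ⟨r₁, r₂, rfl, hx, hyz⟩ := List.cons_sublist_iff.1 h
  obtain ⟨r₃, r₄, rfl, hy, hz⟩ := List.cons_sublist_iff.1 hyz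
  obtain ⟨s, t, rfl⟩ := List.append_of_mem hy
  exact ⟨r₁ ++ s, t ++ r₄, by simp, by simp [hx], by simp [List.singleton_sublist.1 hz]⟩

end Lists

section Zigzags

variable {α : Type*}

/-- `Zig l w`: the list `w` is obtained by successively removing the first or the last entry
of `l`. If the points of `l` are in convex position, in cyclic order, then these are the plane
paths through `l` that can be preceded by a further point between the last and the first one. -/
inductive Zig : List α → List α → Prop
  | nil : Zig [] []
  | head (x : α) {l w : List α} : Zig l w → Zig (x :: l) (x :: w)
  | last (x : α) {l w : List α} : Zig l w → Zig (l ++ [x]) (x :: w)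

/-- The zigzag `w` through `l` begins with the first entry of `l`. -/
def ZigHead (l w : List α) : Prop := ∃ x l' w', l = x :: l' ∧ w = x :: w' ∧ Zig l' w'

/-- The zigzag `w` through `l` begins with the last entry of `l`. -/
def ZigLast (l w : List α) : Prop := ∃ x l' w', l = l' ++ [x] ∧ w = x :: w' ∧ Zig l' w'

lemma Zig.eq_nil_or_zigHead_or_zigLast {l w : List α} (h : Zig l w) :
    (l = [] ∧ w = []) ∨ ZigHead l w ∨ ZigLast l w := by
  cases h with
  | nil => exact .inl ⟨rfl, rfl⟩
  | head x h => exact .inr (.inl ⟨x, _, _, rfl, rfl, h⟩)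
  | last x h => exact .inr (.inr ⟨x, _, _, rfl, rfl, h⟩)

lemma ZigHead.zig {l w : List α} (h : ZigHead l w) : Zig l w := by
  obtain ⟨x, l, w, rfl, rfl, h⟩ := h
  exact h.head x

lemma ZigLast.zig {l w : List α} (h : ZigLast l w) : Zig l w := by
  obtain ⟨x, l, w, rfl, rfl, h⟩ := h
  exact h.last x

lemma ZigHead.length_pos {l w : List α} (h : ZigHead l w) : 0 < l.length := by
  obtain ⟨x, l, w, rfl, -⟩ := h
  simp

lemma Zig.prepend {l w : List α} (h : Zig l w) (s : List α) : Zig (s ++ l) (s ++ w) := by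
  induction s with
  | nil => exact h
  | cons x s ih => exact ih.head x

lemma Zig.append {l w : List α} (h : Zig l w) (s : List α) : Zig (l ++ s) (s.reverse ++ w) := by
  induction s using List.reverseRecOn with
  | nil => simpa using h
  | append_singleton s x ih =>
    rw [List.reverse_append, ← List.append_assoc]
    exact ih.last x

lemma zig_self (l : List α) : Zig l l := by
  simpa using Zig.nil.prepend l

lemma zig_reverse (l : List α) : Zig l l.reverse := by
  simpa using Zig.nil.append l

lemma Zig.perm {l w : List α} (h : Zig l w) : w.Perm l := by
  induction h with
  | nil => exact .refl _
  | head x _ ih => exact ih.cons x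
  | last x _ ih => exact (ih.cons x).trans (List.perm_append_singleton x _).symm

lemma Zig.reverse_left {l w : List α} (h : Zig l w) : Zig l.reverse w := by
  induction h with
  | nil => exact .nil
  | head x _ ih => rw [List.reverse_cons]; exact ih.last x
  | last x _ ih => rw [List.reverse_append]; exact ih.head x

lemma ZigLast.reverse_left {l w : List α} (h : ZigLast l w) : ZigHead l.reverse w := by
  obtain ⟨x, l, w, rfl, rfl, h⟩ := h
  exact ⟨x, _, w, by simp, rfl, h.reverse_left⟩

end Zigzags

section Orientation

/-- Twice the signed area of the triangle `abc`: it is positive if the triangle is oriented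
counterclockwise. -/
def area (a b c : Plane) : ℝ := (b 0 - a 0) * (c 1 - a 1) - (b 1 - a 1) * (c 0 - a 0)

lemma area_rotate (a b c : Plane) : area b c a = area a b c := by unfold area; ring

lemma area_swap (a b c : Plane) : area a c b = -area a b c := by unfold area; ring

lemma area_swap_left (a b c : Plane) : area b a c = -area a b c := by unfold area; ring

lemma area_self_left (a b : Plane) : area a b a = 0 := by unfold area; ring

lemma area_self_right (a b : Plane) : area a b b = 0 := by unfold area; ring

lemma area_add_area_add_area (a b c z : Plane) :
    area a b z + area b c z + area c a z = area a b c := by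
  unfold area; ring

lemma area_combo (a b c d : Plane) {s t : ℝ} (h : s + t = 1) :
    area a b (s • c + t • d) = s * area a b c + t * area a b d := by
  obtain rfl : s = 1 - t := by linarith
  simp only [area, PiLp.add_apply, PiLp.smul_apply, smul_eq_mul]
  ring

lemma plane_ext {p q : Plane} (h0 : p 0 = q 0) (h1 : p 1 = q 1) : p = q := by
  ext i
  fin_cases i
  exacts [h0, h1]

lemma mem_convexHull_of_area {T : Set Plane} {a b c z : Plane} (ha : a ∈ T) (hb : b ∈ T)
    (hc : c ∈ T) (h1 : 0 ≤ area a b z) (h2 : 0 ≤ area b c z) (h3 : 0 ≤ area c a z)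
    (h : 0 < area a b c) : z ∈ convexHull ℝ T := by
  refine mem_convexHull_of_exists_fintype
    ![area b c z / area a b c, area c a z / area a b c, area a b z / area a b c] ![a, b, c]
    (Fin.forall_fin_succ.2 ⟨div_nonneg h2 h.le, Fin.forall_fin_two.2
      ⟨div_nonneg h3 h.le, div_nonneg h1 h.le⟩⟩) ?_
    (Fin.forall_fin_succ.2 ⟨ha, Fin.forall_fin_two.2 ⟨hb, hc⟩⟩) ?_
  · rw [Fin.sum_univ_three]
    simp only [Matrix.cons_val]
    rw [← add_div, ← add_div, div_eq_one_iff_eq h.ne', ← area_add_area_add_area a b c z]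
    ring
  · have hne := h.ne'
    rw [Fin.sum_univ_three]
    simp only [Matrix.cons_val]
    apply plane_ext <;> simp only [PiLp.add_apply, PiLp.smul_apply, smul_eq_mul] <;>
      field_simp <;> unfold area <;> ring

lemma collinear_of_area_eq_zero {a b c : Plane} (hab : a ≠ b) (h : area a b c = 0) :
    Collinear ℝ ({a, b, c} : Set Plane) := by
  have hpos : (b 0 - a 0) ^ 2 + (b 1 - a 1) ^ 2 ≠ 0 := fun h0 => hab <| plane_ext
    (by nlinarith [sq_nonneg (b 0 - a 0), sq_nonneg (b 1 - a 1)])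
    (by nlinarith [sq_nonneg (b 0 - a 0), sq_nonneg (b 1 - a 1)])
  have hc : ∃ t : ℝ, c = t • (b - a) + a := by
    -- `c - a` is its own orthogonal projection onto the line spanned by `b - a`
    refine ⟨((b 0 - a 0) * (c 0 - a 0) + (b 1 - a 1) * (c 1 - a 1)) /
      ((b 0 - a 0) ^ 2 + (b 1 - a 1) ^ 2), ?_⟩
    unfold area at h
    apply plane_ext <;>
      simp only [PiLp.add_apply, PiLp.sub_apply, PiLp.smul_apply, smul_eq_mul] <;> field_simp
    · linear_combination -(b 1 - a 1) * h
    · linear_combination (b 0 - a 0) * h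
  rw [collinear_iff_of_mem (p₀ := a) (by simp)]
  refine ⟨b - a, ?_⟩
  simp only [Set.forall_mem_insert, Set.mem_singleton_iff, forall_eq]
  exact ⟨⟨0, by simp⟩, ⟨1, by simp⟩, hc⟩

lemma area_ne_zero {S : Set Plane} (hS : InGeneralPosition S) {a b c : Plane}
    (ha : a ∈ S) (hb : b ∈ S) (hc : c ∈ S) (hab : a ≠ b) (hac : a ≠ c) (hbc : b ≠ c) :
    area a b c ≠ 0 :=
  fun h => hS a ha b hb c hc hab hac hbc (collinear_of_area_eq_zero hab h)

end Orientation

section Segments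

/-- The segments `ab` and `cd` have a common point. -/
def Meets (a b c d : Plane) : Prop := (segment ℝ a b ∩ segment ℝ c d).Nonempty

lemma Meets.symm {a b c d : Plane} (h : Meets a b c d) : Meets c d a b := by
  unfold Meets; rwa [Set.inter_comm]

lemma Meets.swap_left {a b c d : Plane} (h : Meets a b c d) : Meets b a c d := by
  unfold Meets; rwa [segment_symm]

lemma Meets.swap_right {a b c d : Plane} (h : Meets a b c d) : Meets a b d c := by
  unfold Meets; rwa [segment_symm ℝ d c]

lemma meets_of_area {c x y z : Plane} (h1 : 0 < area c x z) (h2 : 0 < area c z y)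
    (h3 : 0 ≤ area c x y) (h4 : area x y z ≤ 0) : Meets c z x y := by
  have hsum : area c x z + area c z y = area c x y - area x y z := by unfold area; ring
  have hpos : 0 < area c x z + area c z y := by linarith
  have hne := hpos.ne'
  refine ⟨(area c z y / (area c x z + area c z y)) • x +
    (area c x z / (area c x z + area c z y)) • y,
    ⟨1 - area c x y / (area c x z + area c z y), area c x y / (area c x z + area c z y),
      ?_, by positivity, by ring, ?_⟩,
    _, _, by positivity, by positivity, by field_simp; ring, rfl⟩
  · rw [sub_nonneg, div_le_one hpos]
    linarith
  · apply plane_ext <;> simp only [PiLp.add_apply, PiLp.smul_apply, smul_eq_mul] <;>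
      field_simp <;> unfold area <;> ring

lemma not_meets_of_area_pos {a b c d : Plane} (hc : 0 < area a b c) (hd : 0 < area a b d) :
    ¬ Meets a b c d := by
  rintro ⟨p, ⟨s, t, -, -, hst, rfl⟩, s', t', hs', ht', hst', h⟩
  have h0 : area a b (s • a + t • b) = 0 := by
    rw [area_combo _ _ _ _ hst, area_self_left, area_self_right]; ring
  rw [← h, area_combo _ _ _ _ hst'] at h0
  rcases hs'.eq_or_lt with rfl | hs'
  · obtain rfl : t' = 1 := by linarith
    linarith
  · linarith [mul_pos hs' hc, mul_nonneg ht' hd.le]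

lemma not_meets_of_area_neg {a b c d : Plane} (hc : area a b c < 0) (hd : area a b d < 0) :
    ¬ Meets a b c d := by
  rw [← neg_pos, ← area_swap_left] at hc hd
  exact fun h => not_meets_of_area_pos hc hd h.swap_left

lemma segment_inter_segment_subset_of_area_ne {a b d : Plane} (h : area a b d ≠ 0) :
    segment ℝ a b ∩ segment ℝ a d ⊆ {a} := by
  rintro p ⟨⟨s, t, -, -, hst, rfl⟩, s', t', hs', ht', hst', hp⟩
  have h0 : area a b (s • a + t • b) = 0 := by
    rw [area_combo _ _ _ _ hst, area_self_left, area_self_right]; ring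
  rw [← hp, area_combo _ _ _ _ hst', area_self_left, mul_zero, zero_add] at h0
  obtain rfl : t' = 0 := (mul_eq_zero.1 h0).resolve_right h
  obtain rfl : s' = 1 := by linarith
  simp [← hp]

end Segments

section CyclicOrder

/-- All triples of the list are oriented counterclockwise. -/
def CCW (l : List Plane) : Prop := ∀ x y z, [x, y, z].Sublist l → 0 < area x y z

lemma CCW.sublist {l l' : List Plane} (h : CCW l) (hl : l'.Sublist l) : CCW l' :=
  fun x y z hs => h x y z (hs.trans hl)

lemma CCW.rotate {l₁ l₂ : List Plane} (h : CCW (l₁ ++ l₂)) : CCW (l₂ ++ l₁) := by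
  intro x y z hs
  obtain ⟨s, t, hst, hs, ht⟩ := List.sublist_append_iff.1 hs
  have hts := ht.append hs
  match s with
  | [] =>
    obtain rfl : [x, y, z] = t := hst
    exact h _ _ _ (by simpa only [List.append_nil] using hts)
  | [_] =>
    obtain ⟨rfl, rfl⟩ : x = _ ∧ [y, z] = t := List.cons_eq_cons.1 hst
    rw [← area_rotate]
    exact h _ _ _ hts
  | [_, _] =>
    obtain ⟨rfl, rfl, rfl⟩ : x = _ ∧ y = _ ∧ [z] = t := by
      simpa only [List.cons_append, List.nil_append, List.cons.injEq] using hst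
    rw [← area_rotate, ← area_rotate]
    exact h _ _ _ hts
  | _ :: _ :: _ :: s =>
    obtain ⟨rfl, rfl, rfl, rfl, rfl⟩ : x = _ ∧ y = _ ∧ z = _ ∧ s = [] ∧ t = [] := by
      simpa only [List.cons_append, List.cons.injEq, List.nil_eq, List.append_eq_nil_iff] using hst
    exact h _ _ _ hts

/-- The list runs through the vertices of a convex polygon in cyclic order. -/
def CyclicOrder (l : List Plane) : Prop := CCW l ∨ CCW l.reverse

lemma CyclicOrder.sublist {l l' : List Plane} (h : CyclicOrder l) (hl : l'.Sublist l) :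
    CyclicOrder l' :=
  h.imp (fun h => h.sublist hl) (fun h => h.sublist hl.reverse)

lemma CyclicOrder.rotate {l₁ l₂ : List Plane} (h : CyclicOrder (l₁ ++ l₂)) :
    CyclicOrder (l₂ ++ l₁) := by
  refine h.imp CCW.rotate fun h => ?_
  rw [List.reverse_append] at h ⊢
  exact h.rotate

lemma CyclicOrder.reverse {l : List Plane} (h : CyclicOrder l) : CyclicOrder l.reverse := by
  unfold CyclicOrder
  rw [List.reverse_reverse]
  exact h.symm

lemma CCW.sides_diagonals {x y z w : Plane} (h : CCW [x, y, z, w]) :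
    ¬ Meets x y z w ∧ ¬ Meets y z x w ∧ Meets x z y w := by
  have hxyz := h x y z (by simp)
  have hxyw := h x y w (by simp)
  have hxzw := h x z w (by simp)
  have hyzw := h y z w (by simp)
  refine ⟨not_meets_of_area_pos hxyz hxyw, not_meets_of_area_pos ?_ hyzw,
    meets_of_area hxyz hxzw hxyw.le ?_⟩
  · rwa [area_rotate]
  · rw [area_swap]; linarith

lemma CyclicOrder.sides_diagonals {x y z w : Plane} (h : CyclicOrder [x, y, z, w]) :
    ¬ Meets x y z w ∧ ¬ Meets y z x w ∧ Meets x z y w := by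
  rcases h with h | h
  · exact h.sides_diagonals
  · obtain ⟨h₁, h₂, h₃⟩ := CCW.sides_diagonals h
    exact ⟨fun h => h₁ h.symm.swap_left.swap_right, fun h => h₂ h.swap_left.swap_right,
      h₃.symm.swap_left.swap_right⟩

/-- The list enumerates the set in cyclic order. -/
structure IsHull (C : Set Plane) (l : List Plane) : Prop where
  nodup : l.Nodup
  mem_iff : ∀ x, x ∈ l ↔ x ∈ C
  cyclic : CyclicOrder l

variable {C : Set Plane}

lemma IsHull.rotate {l₁ l₂ : List Plane} (h : IsHull C (l₁ ++ l₂)) : IsHull C (l₂ ++ l₁) :=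
  ⟨(List.perm_append_comm.nodup_iff).1 h.nodup,
    fun x => by rw [← h.mem_iff, List.mem_append, List.mem_append, or_comm], h.cyclic.rotate⟩

lemma IsHull.reverse {l : List Plane} (h : IsHull C l) : IsHull C l.reverse :=
  ⟨List.nodup_reverse.2 h.nodup, fun x => by rw [List.mem_reverse, h.mem_iff], h.cyclic.reverse⟩

lemma IsHull.perm {l l' : List Plane} (h : IsHull C l) (h' : IsHull C l') : l.Perm l' :=
  (List.perm_ext_iff_of_nodup h.nodup h'.nodup).2 fun x => by rw [h.mem_iff, h'.mem_iff]

lemma area_trans (hC : InConvexPosition C) {p x y z : Plane} (hp : p ∈ C) (hx : x ∈ C \ {p})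
    (hy : y ∈ C \ {p}) (hz : z ∈ C \ {p}) (hxy : 0 < area p x y) (hyz : 0 < area p y z) :
    0 < area p x z := by
  by_contra! hxz
  refine convexIndependent_set_iff_notMem_convexHull_sdiff.1 hC p hp
    (mem_convexHull_of_area hx hy hz ?_ ?_ ?_ ?_)
  · rw [area_rotate]; exact hxy.le
  · rw [area_rotate]; exact hyz.le
  · rw [area_rotate, area_swap]; linarith
  · linarith [area_add_area_add_area x y z p, area_rotate p x y, area_rotate p y z,
      area_rotate p z x, area_swap p x z]

lemma area_pos_of_fan (hC : InConvexPosition C) {p x y z : Plane} (hp : p ∈ C) (hx : x ∈ C)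
    (hy : y ∈ C) (hz : z ∈ C) (hpxy : 0 < area p x y) (hpyz : 0 < area p y z)
    (hpxz : 0 < area p x z) : 0 < area x y z := by
  have hne : p ≠ y ∧ x ≠ y ∧ z ≠ y := by
    refine ⟨?_, ?_, ?_⟩ <;> rintro rfl <;>
      simp only [area_self_left, area_self_right, lt_self_iff_false] at hpxy hpyz
  by_contra! hneg
  refine convexIndependent_set_iff_notMem_convexHull_sdiff.1 hC y hy
    (mem_convexHull_of_area ⟨hp, hne.1⟩ ⟨hx, hne.2.1⟩ ⟨hz, hne.2.2⟩ hpxy.le ?_ ?_ hpxz)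
  · rw [area_swap]; linarith
  · rw [← area_rotate]; exact hpyz.le

lemma ccw_cons_of_pairwise (hC : InConvexPosition C) {p : Plane} {l : List Plane} (hp : p ∈ C)
    (hl : ∀ x ∈ l, x ∈ C) (h : l.Pairwise (fun x y => 0 < area p x y)) : CCW (p :: l) := by
  intro x y z hs
  rcases List.sublist_cons_iff.1 hs with hs | ⟨r, hr, hs⟩
  · have hfan := h.sublist hs
    simp only [List.pairwise_cons, List.forall_mem_cons] at hfan
    have hmem : ∀ u ∈ [x, y, z], u ∈ C := fun u hu => hl u (hs.subset hu)
    exact area_pos_of_fan hC hp (hmem x (by simp)) (hmem y (by simp)) (hmem z (by simp))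
      hfan.1.1 hfan.2.1.1 hfan.1.2.1
  · obtain ⟨rfl, rfl⟩ := List.cons_eq_cons.1 hr
    exact List.pairwise_iff_forall_sublist.1 h hs

lemma CCW.pairwise {p : Plane} {l : List Plane} (h : CCW (p :: l)) :
    l.Pairwise (fun x y => 0 < area p x y) :=
  List.pairwise_iff_forall_sublist.2 fun hs => h p _ _ (hs.cons_cons p)

lemma exists_hull (hfin : C.Finite) (hne : C.Nonempty) (hC : InConvexPosition C)
    (hgen : InGeneralPosition C) : ∃ l, IsHull C l ∧ CCW l := by
  classical
  obtain ⟨p, hp⟩ := hne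
  have hs : ∀ x, x ∈ hfin.toFinset.erase p ↔ x ∈ C \ {p} := by simp [and_comm]
  obtain ⟨l, hl, hmem, hr⟩ := exists_pairwise_list (hfin.toFinset.erase p)
    (fun x y => 0 < area p x y)
    (fun x hx y hy hxy => by
      rw [hs] at hx hy
      rw [area_swap p x y, neg_pos]
      exact (area_ne_zero hgen hp hx.1 hy.1 (Ne.symm hx.2) (Ne.symm hy.2) hxy).lt_or_gt.symm)
    (fun x hx y hy z hz =>
      area_trans hC hp ((hs x).1 hx) ((hs y).1 hy) ((hs z).1 hz))
  simp only [hs] at hmem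
  have hccw := ccw_cons_of_pairwise hC hp (fun x hx => ((hmem x).1 hx).1) hr
  refine ⟨p :: l, ⟨List.nodup_cons.2 ⟨by simp [hmem], hl⟩, fun x => ?_, .inl hccw⟩, hccw⟩
  rw [List.mem_cons, hmem, ← Set.mem_singleton_iff, ← Set.mem_union,
    Set.union_sdiff_cancel (Set.singleton_subset_iff.2 hp)]

lemma CCW.isRotated {l l' : List Plane} (hl : CCW l) (hl' : CCW l') (h : IsHull C l)
    (h' : IsHull C l') : ∃ M N, l = M ++ N ∧ l' = N ++ M := by
  rcases l with _ | ⟨a, t⟩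
  · exact ⟨[], [], rfl, List.nil_perm.1 (h.perm h')⟩
  · obtain ⟨N, M, rfl⟩ := List.append_of_mem ((h'.mem_iff a).2 ((h.mem_iff a).1 (by simp)))
    have ht : t = M ++ N := by
      refine List.Perm.eq_of_pairwise (le := fun x y => 0 < area a x y) ?_ hl.pairwise
        hl'.rotate.pairwise (h.perm h'.rotate).cons_inv
      intro x y _ _ hxy hyx
      rw [area_swap] at hyx
      linarith
    exact ⟨a :: M, N, by rw [ht]; rfl, rfl⟩

/-- The point `ξ` sees the point `c` past the segments spanned by `T`. -/
def SeesPast (ξ : Plane) (T : Set Plane) (c : Plane) : Prop :=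
  ∀ x ∈ T, ∀ y ∈ T, x ≠ y → x ≠ c → y ≠ c → ¬ Meets ξ c x y

lemma SeesPast.mono {ξ c : Plane} {T T' : Set Plane} (h : SeesPast ξ T c) (hT : T' ⊆ T) :
    SeesPast ξ T' c :=
  fun x hx y hy => h x (hT hx) y (hT hy)

/-- The first entry of `l`, if there is one, is visible from `ξ` past all segments of `C`. -/
def HeadVisible (C : Set Plane) (ξ : Plane) (l : List Plane) : Prop :=
  ∀ a ∈ l.head?, SeesPast ξ C a

lemma headVisible_cons {ξ a : Plane} {l : List Plane} :
    HeadVisible C ξ (a :: l) ↔ SeesPast ξ C a := by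
  simp [HeadVisible]

lemma HeadVisible.of_forall {ξ : Plane} {l : List Plane} (h : ∀ x ∈ l, SeesPast ξ C x) :
    HeadVisible C ξ l :=
  fun x hx => h x (List.mem_of_head? hx)

lemma HeadVisible.append {ξ : Plane} {l l' : List Plane} (h : HeadVisible C ξ l)
    (h' : l = [] → HeadVisible C ξ l') : HeadVisible C ξ (l ++ l') := by
  rcases l with _ | ⟨a, l⟩
  · exact h' rfl
  · exact headVisible_cons.2 (headVisible_cons.1 h)

lemma HeadVisible.of_append {ξ : Plane} {l l' : List Plane} (h : HeadVisible C ξ (l ++ l'))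
    (hl : l ≠ []) : HeadVisible C ξ l := by
  obtain ⟨a, l, rfl⟩ := List.exists_cons_of_ne_nil hl
  exact headVisible_cons.2 (headVisible_cons.1 h)

end CyclicOrder

section OuterPoint

/-- Points in convex position and a point outside of their convex hull, in general position. -/
structure OuterPoint (C : Set Plane) (ξ : Plane) : Prop where
  finite : C.Finite
  convex : InConvexPosition C
  outside : ξ ∉ convexHull ℝ C
  general : InGeneralPosition (insert ξ C)

variable {C : Set Plane} {ξ : Plane}

lemma OuterPoint.notMem (h : OuterPoint C ξ) : ξ ∉ C :=
  fun hξ => h.outside (subset_convexHull ℝ C hξ)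

lemma OuterPoint.area_ne_zero (h : OuterPoint C ξ) {a b : Plane} (ha : a ∈ C) (hb : b ∈ C)
    (hab : a ≠ b) : area a b ξ ≠ 0 :=
  PlanePaths.area_ne_zero h.general (.inr ha) (.inr hb) (.inl rfl) hab
    (fun e => h.notMem (e ▸ ha)) (fun e => h.notMem (e ▸ hb))

lemma OuterPoint.exists_hull (h : OuterPoint C ξ) (hne : C.Nonempty) : ∃ l, IsHull C l ∧ CCW l :=
  PlanePaths.exists_hull h.finite hne h.convex
    fun x hx y hy z hz => h.general x (.inr hx) y (.inr hy) z (.inr hz)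

lemma OuterPoint.area_neg (h : OuterPoint C ξ) {c x y : Plane} (hc : c ∈ C) (hx : x ∈ C)
    (hy : y ∈ C) (h1 : 0 < area c x ξ) (h2 : 0 < area c ξ y) (h3 : 0 < area c x y) :
    area x y ξ < 0 := by
  by_contra! hneg
  refine h.outside (mem_convexHull_of_area hc hx hy h1.le hneg ?_ h3)
  rw [← area_rotate y c ξ]
  exact h2.le

lemma OuterPoint.meets (h : OuterPoint C ξ) {c x y : Plane} (hc : c ∈ C) (hx : x ∈ C)
    (hy : y ∈ C) (h1 : 0 < area c x ξ) (h2 : 0 < area c ξ y) (h3 : 0 < area c x y) :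
    Meets ξ c x y :=
  (meets_of_area h1 h2 h3.le (h.area_neg hc hx hy h1 h2 h3).le).swap_left

lemma OuterPoint.area_pos_of_meets (h : OuterPoint C ξ) {a x y : Plane} (ha : a ∈ C)
    (hx : x ∈ C) (hy : y ∈ C) (hxa : x ≠ a) (hya : y ≠ a) (hm : Meets ξ a x y)
    (hpos : 0 < area a x y) : 0 < area a x ξ ∧ 0 < area a ξ y := by
  obtain ⟨_, ⟨s, t, hs, -, hst, rfl⟩, s', t', hs', ht', hst', hp⟩ := hm
  have hx' : s * area a x ξ = t' * area a x y := by
    have e := congrArg (area a x) hp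
    rw [area_combo _ _ _ _ hst, area_combo _ _ _ _ hst', area_self_left, area_self_right] at e
    linarith
  have hy' : s * area a ξ y = s' * area a x y := by
    have e := congrArg (area a y) hp
    rw [area_combo _ _ _ _ hst, area_combo _ _ _ _ hst', area_self_left, area_self_right,
      area_swap a x y, area_swap a ξ y] at e
    linarith
  have hs0 : 0 < s := by
    refine hs.lt_of_ne' fun hs0 => ?_
    rw [hs0, zero_mul, zero_eq_mul, or_iff_left hpos.ne'] at hx' hy'
    linarith
  have hnx := h.area_ne_zero ha hx hxa.symm
  have hny := h.area_ne_zero ha hy hya.symm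
  rw [area_swap, neg_ne_zero] at hny
  exact ⟨(nonneg_of_mul_nonneg_right (hx' ▸ by positivity) hs0).lt_of_ne' hnx,
    (nonneg_of_mul_nonneg_right (hy' ▸ by positivity) hs0).lt_of_ne' hny⟩

lemma area_mul_area (a p x y z : Plane) :
    area a p z * area a x y = area a z y * area a p x + area a x z * area a p y := by
  unfold area; ring

lemma OuterPoint.exists_blocking_pair (h : OuterPoint C ξ) {a : Plane} {l : List Plane}
    (hl : IsHull C (a :: l)) (hccw : CCW (a :: l)) (hvis : ¬ SeesPast ξ C a) :
    ∃ x y, [x, y].Sublist l ∧ 0 < area a x ξ ∧ 0 < area a ξ y := by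
  have haC : a ∈ C := (hl.mem_iff a).1 List.mem_cons_self
  have hpos : ∀ x y, [x, y].Sublist l → 0 < area a x y :=
    fun x y hxy => hccw a x y (hxy.cons_cons a)
  simp only [SeesPast, not_forall, not_not] at hvis
  obtain ⟨x, hx, y, hy, hxy, hxa, hya, hm⟩ := hvis
  have hxl := (List.mem_cons.1 ((hl.mem_iff x).2 hx)).resolve_left hxa
  have hyl := (List.mem_cons.1 ((hl.mem_iff y).2 hy)).resolve_left hya
  rcases pair_sublist_or hxl hyl hxy with hs | hs
  · exact ⟨x, y, hs, h.area_pos_of_meets haC hx hy hxa hya hm (hpos _ _ hs)⟩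
  · exact ⟨y, x, hs, h.area_pos_of_meets haC hy hx hya hxa hm.swap_right (hpos _ _ hs)⟩

lemma OuterPoint.area_pos_of_hidden_of_head (h : OuterPoint C ξ) {a f : Plane} {t : List Plane}
    (hl : IsHull C (a :: f :: t)) (hccw : CCW (a :: f :: t)) (hvis : ¬ SeesPast ξ C a) :
    0 < area a f ξ := by
  obtain ⟨x, y, hxy, hx, hy⟩ := h.exists_blocking_pair hl hccw hvis
  rcases List.sublist_cons_iff.1 hxy with hs | ⟨r, hr, -⟩
  · have hafx := hccw a f x (by simpa using hs.subset List.mem_cons_self)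
    have hafy := hccw a f y (by simpa using hs.subset (by simp))
    have haxy := hccw a x y (hxy.cons_cons a)
    refine pos_of_mul_pos_left ?_ haxy.le
    rw [area_mul_area]
    positivity
  · rwa [← (List.cons_eq_cons.1 hr).1]

lemma OuterPoint.area_pos_of_hidden_of_last (h : OuterPoint C ξ) {a g : Plane} {t : List Plane}
    (hl : IsHull C (a :: (t ++ [g]))) (hccw : CCW (a :: (t ++ [g])))
    (hvis : ¬ SeesPast ξ C a) : 0 < area a ξ g := by
  obtain ⟨x, y, hxy, hx, hy⟩ := h.exists_blocking_pair hl hccw hvis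
  have hlast : ∀ z ∈ t, 0 < area a z g := fun z hz =>
    hccw a z g (((List.singleton_sublist.2 hz).append (.refl [g])).cons_cons a)
  have hmem : ∀ z ∈ [x, y], z ∈ t ∨ z = g := fun z hz => by simpa using hxy.subset hz
  rcases hmem y (by simp) with hyt | rfl
  · have haxg : 0 < area a x g := by
      rcases hmem x (by simp) with hxt | rfl
      · exact hlast x hxt
      · exact absurd (hccw a x y (hxy.cons_cons a)) (by rw [area_swap]; linarith [hlast y hyt])
    have haxy := hccw a x y (hxy.cons_cons a)
    have key := area_mul_area a g x y ξ
    rw [area_swap a x g, area_swap a y g, area_swap a ξ g] at key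
    refine pos_of_mul_pos_left ?_ haxy.le
    linarith [mul_pos hy haxg, mul_pos hx (hlast y hyt)]
  · exact hy

lemma pairwise_area_pos_of_head {a f : Plane} {t : List Plane} (hccw : CCW (a :: f :: t))
    (hf : 0 < area a f ξ) :
    (f :: t).Pairwise (fun x y => 0 < area a ξ x → 0 < area a ξ y) := by
  refine List.pairwise_iff_forall_sublist.2 fun {x y} hxy hx => ?_
  rw [area_swap, neg_pos] at hx
  rcases List.sublist_cons_iff.1 hxy with hs | ⟨r, hr, -⟩
  · have hafx := hccw a f x (by simpa using hs.subset List.mem_cons_self)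
    have hafy := hccw a f y (by simpa using hs.subset (by simp))
    have haxy := hccw a x y (hxy.cons_cons a)
    refine pos_of_mul_pos_left (b := area a f x) ?_ hafx.le
    linarith [area_mul_area a f x y ξ, mul_pos hf haxy, mul_neg_of_neg_of_pos hx hafy]
  · obtain ⟨rfl, -⟩ := List.cons_eq_cons.1 hr
    linarith

lemma OuterPoint.seesPast_of_supporting (h : OuterPoint C ξ) {u v c : Plane} (hcC : c ∈ C)
    (hsup : ∀ z ∈ C, 0 ≤ area u v z) (hneg : area u v ξ < 0) (hc : area u v c = 0) :
    SeesPast ξ C c := by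
  rintro x hx y hy hxy hxc hyc ⟨_, ⟨s, t, hs, -, hst, rfl⟩, s', t', hs', ht', hst', hp⟩
  have e := congrArg (area u v) hp
  rw [area_combo _ _ _ _ hst, area_combo _ _ _ _ hst', hc] at e
  have hs0 : s = 0 := by
    refine (hs.eq_or_lt.resolve_right fun hs0 => ?_).symm
    linarith [mul_nonneg hs' (hsup x hx), mul_nonneg ht' (hsup y hy),
      mul_neg_of_pos_of_neg hs0 hneg]
  have ht1 : t = 1 := by linarith
  rw [hs0, ht1, zero_smul, one_smul, zero_add] at hp
  refine PlanePaths.area_ne_zero h.general (.inr hx) (.inr hy) (.inr hcC) hxy hxc hyc ?_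
  rw [← hp, area_combo _ _ _ _ hst', area_self_left, area_self_right]
  ring

lemma CCW.area_nonneg_of_edge {u v : Plane} {A B : List Plane} (h : CCW (A ++ u :: v :: B)) :
    ∀ z ∈ A ++ u :: v :: B, 0 ≤ area u v z := by
  intro z hz
  have hz' : z = u ∨ z = v ∨ z ∈ B ++ A := by
    simp only [List.mem_append, List.mem_cons] at hz ⊢
    tauto
  rcases hz' with rfl | rfl | hz'
  · rw [area_self_left]
  · rw [area_self_right]
  · exact (h.rotate u v z (((List.singleton_sublist.2 hz').cons_cons v).cons_cons u)).le

lemma OuterPoint.seesPast_of_edge (h : OuterPoint C ξ) {u v : Plane} {A B : List Plane}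
    (hl : IsHull C (A ++ u :: v :: B)) (hccw : CCW (A ++ u :: v :: B)) (hneg : area u v ξ < 0) :
    SeesPast ξ C u ∧ SeesPast ξ C v := by
  have hsup : ∀ z ∈ C, 0 ≤ area u v z := fun z hz =>
    hccw.area_nonneg_of_edge z ((hl.mem_iff z).2 hz)
  exact ⟨h.seesPast_of_supporting ((hl.mem_iff u).1 (by simp)) hsup hneg (area_self_left u v),
    h.seesPast_of_supporting ((hl.mem_iff v).1 (by simp)) hsup hneg (area_self_right u v)⟩

end OuterPoint

section IsSplit

variable {C : Set Plane} {ξ : Plane}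

/-- The points of `C` other than `a`, which is hidden from `ξ`, on the two sides of the line
through `ξ` and `a`, listed in cyclic order from `a` to `a`: the segments crossing `ξa` are those
from `R` to `L`. -/
structure IsSplit (C : Set Plane) (ξ a : Plane) (R L : List Plane) : Prop where
  left_ne : R ≠ []
  right_ne : L ≠ []
  meets : ∀ x ∈ R, ∀ y ∈ L, Meets ξ a x y
  sees_left : SeesPast ξ {x | x ∈ R} a
  sees_right : SeesPast ξ {x | x ∈ L} a
  last_visible : HeadVisible C ξ R.reverse
  head_visible : HeadVisible C ξ L

lemma IsSplit.reverse {a : Plane} {R L : List Plane} (hs : IsSplit C ξ a R L) :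
    IsSplit C ξ a L.reverse R.reverse where
  left_ne := List.reverse_ne_nil_iff.2 hs.right_ne
  right_ne := List.reverse_ne_nil_iff.2 hs.left_ne
  meets x hx y hy :=
    (hs.meets y (List.mem_reverse.1 hy) x (List.mem_reverse.1 hx)).swap_right
  sees_left := hs.sees_right.mono fun _ => List.mem_reverse.1
  sees_right := hs.sees_left.mono fun _ => List.mem_reverse.1
  last_visible := by rw [List.reverse_reverse]; exact hs.head_visible
  head_visible := hs.last_visible

lemma OuterPoint.isSplit_of_area (h : OuterPoint C ξ) {a u v : Plane} {R L : List Plane}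
    (hl : IsHull C (a :: (R ++ [u] ++ v :: L))) (hccw : CCW (a :: (R ++ [u] ++ v :: L)))
    (hR : ∀ x ∈ R ++ [u], 0 < area a x ξ) (hL : ∀ y ∈ v :: L, 0 < area a ξ y) :
    IsSplit C ξ a (R ++ [u]) (v :: L) := by
  have hmem : ∀ x ∈ a :: (R ++ [u] ++ v :: L), x ∈ C := fun x => (hl.mem_iff x).1
  have hcross : ∀ x ∈ R ++ [u], ∀ y ∈ v :: L, 0 < area a x y := fun x hx y hy =>
    hccw a x y (((List.singleton_sublist.2 hx).append (List.singleton_sublist.2 hy)).cons_cons a)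
  have hsees : SeesPast ξ C u ∧ SeesPast ξ C v :=
    h.seesPast_of_edge (A := a :: R) (B := L) (by simpa using hl) (by simpa using hccw)
      (h.area_neg (hmem a (by simp)) (hmem u (by simp)) (hmem v (by simp)) (hR u (by simp))
        (hL v (by simp)) (hcross u (by simp) v (by simp)))
  refine ⟨by simp, by simp, fun x hx y hy => ?_, fun x hx y hy _ _ _ hm => ?_,
    fun x hx y hy _ _ _ hm => ?_, by simpa [headVisible_cons] using hsees.1,
    headVisible_cons.2 hsees.2⟩
  · exact h.meets (hmem a (by simp)) (hmem x (List.mem_cons_of_mem _ (List.mem_append_left _ hx)))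
      (hmem y (List.mem_cons_of_mem _ (List.mem_append_right _ hy))) (hR x hx) (hL y hy)
      (hcross x hx y hy)
  · have hx := hR x hx
    have hy := hR y hy
    rw [area_swap, neg_pos] at hx hy
    exact not_meets_of_area_neg hx hy hm.swap_left
  · exact not_meets_of_area_pos (hL x hx) (hL y hy) hm.swap_left

lemma OuterPoint.exists_isSplit_of_ccw (h : OuterPoint C ξ) {a : Plane} {l : List Plane}
    (hl : IsHull C (a :: l)) (hccw : CCW (a :: l)) (hvis : ¬ SeesPast ξ C a) :
    ∃ R L, l = R ++ L ∧ IsSplit C ξ a R L := by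
  obtain ⟨x, y, hxy, hx, hy⟩ := h.exists_blocking_pair hl hccw hvis
  obtain ⟨f, t, rfl⟩ := List.exists_cons_of_ne_nil (List.ne_nil_of_mem
    (hxy.subset List.mem_cons_self))
  obtain ⟨R, L, hRL, hR, hL⟩ := exists_append_of_pairwise_imp _ _
    (pairwise_area_pos_of_head hccw (h.area_pos_of_hidden_of_head hl hccw hvis))
  rw [hRL] at hl hccw hxy ⊢
  have hR' : ∀ z ∈ R, 0 < area a z ξ := fun z hz => by
    have hne := h.area_ne_zero ((hl.mem_iff a).1 (by simp)) ((hl.mem_iff z).1 (by simp [hz]))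
      (fun e => (List.nodup_cons.1 hl.nodup).1 (by simp [e, hz]))
    have := hR z hz
    rw [area_swap, neg_pos, not_lt] at this
    exact this.lt_of_ne' hne
  have hRne : R ≠ [] := by
    rintro rfl
    have := hL x (hxy.subset (by simp))
    rw [area_swap] at this
    linarith
  have hLne : L ≠ [] := by
    rintro rfl
    exact hR y (by simpa using hxy.subset (by simp)) hy
  obtain ⟨R, u, rfl⟩ := (List.eq_nil_or_concat' R).resolve_left hRne
  obtain ⟨v, L, rfl⟩ := List.exists_cons_of_ne_nil hLne
  exact ⟨_, _, rfl, h.isSplit_of_area hl hccw hR' hL⟩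

lemma OuterPoint.exists_isSplit (h : OuterPoint C ξ) {a : Plane} {l : List Plane}
    (hl : IsHull C (a :: l)) (hvis : ¬ SeesPast ξ C a) :
    ∃ R L, l = R ++ L ∧ IsSplit C ξ a R L := by
  rcases hl.cyclic with hc | hc
  · exact h.exists_isSplit_of_ccw hl hc hvis
  · have hl' := hl.reverse
    rw [List.reverse_cons] at hc hl'
    obtain ⟨R, L, hRL, hs⟩ := h.exists_isSplit_of_ccw hl'.rotate hc.rotate hvis
    exact ⟨L.reverse, R.reverse, by
      rw [← List.reverse_append, ← hRL, List.append_eq, List.nil_append, List.reverse_reverse],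
      hs.reverse⟩

end IsSplit

section VisibleArc

variable {C : Set Plane} {ξ : Plane}

lemma OuterPoint.area_neg_of_hidden_of_pos (h : OuterPoint C ξ) {a b x : Plane}
    {X₁ X₂ Y : List Plane} (hl : IsHull C (x :: (X₂ ++ b :: Y ++ a :: X₁)))
    (hccw : CCW (x :: (X₂ ++ b :: Y ++ a :: X₁))) (hx : ¬ SeesPast ξ C x) (hb : SeesPast ξ C b)
    (hxb : 0 < area x b ξ) : area b a ξ < 0 := by
  have hmem : ∀ z ∈ x :: (X₂ ++ b :: Y ++ a :: X₁), z ∈ C := fun z => (hl.mem_iff z).1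
  have hsub : (x :: b :: a :: X₁).Sublist (x :: (X₂ ++ b :: Y ++ a :: X₁)) := by simp
  have hxba := hccw x b a (.trans (by simp) hsub)
  rcases List.eq_nil_or_concat' X₁ with rfl | ⟨X₁, z, rfl⟩
  · exact h.area_neg (hmem x (by simp)) (hmem b (by simp)) (hmem a (by simp)) hxb
      (h.area_pos_of_hidden_of_last hl hccw hx) hxba
  · have hz : 0 < area x ξ z :=
      h.area_pos_of_hidden_of_last (t := X₂ ++ b :: Y ++ a :: X₁) (by simpa using hl)
        (by simpa using hccw) hx
    have hbz : area b z ξ < 0 :=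
      h.area_neg (hmem x (by simp)) (hmem b (by simp)) (hmem z (by simp)) hxb hz
        (hccw x b z (.trans (by simp) hsub))
    have hnd : [b, a, z].Nodup := hl.nodup.sublist (.trans (by simp) hsub)
    simp only [List.nodup_cons, List.mem_cons, List.not_mem_nil, or_false, not_or] at hnd
    by_contra! hab
    refine hb a (hmem a (by simp)) z (hmem z (by simp)) hnd.2.1 (Ne.symm hnd.1.1)
      (Ne.symm hnd.1.2) (h.meets (hmem b (by simp)) (hmem a (by simp)) (hmem z (by simp))
        (hab.lt_of_ne' (h.area_ne_zero (hmem b (by simp)) (hmem a (by simp)) hnd.1.1)) ?_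
        (hccw b a z (.trans (by simp) hsub)))
    rw [area_swap]
    linarith

lemma OuterPoint.area_neg_of_hidden_of_neg (h : OuterPoint C ξ) {a b x : Plane}
    {X₁ X₂ Y : List Plane} (hl : IsHull C (x :: (X₂ ++ b :: Y ++ a :: X₁)))
    (hccw : CCW (x :: (X₂ ++ b :: Y ++ a :: X₁))) (hx : ¬ SeesPast ξ C x) (ha : SeesPast ξ C a)
    (hxb : area x b ξ < 0) : area b a ξ < 0 := by
  have hmem : ∀ z ∈ x :: (X₂ ++ b :: Y ++ a :: X₁), z ∈ C := fun z => (hl.mem_iff z).1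
  rcases X₂ with _ | ⟨r, X₂⟩
  · exact absurd (h.area_pos_of_hidden_of_head hl hccw hx) hxb.not_gt
  have hsub : [x, r, b, a].Sublist (x :: (r :: X₂ ++ b :: Y ++ a :: X₁)) := by simp
  have hr := h.area_pos_of_hidden_of_head hl hccw hx
  have hxa : 0 < area x ξ a := by
    have hba := (pairwise_area_pos_of_head hccw hr).sublist
      (show [b, a].Sublist (r :: (X₂ ++ b :: Y ++ a :: X₁)) by simp)
    refine (List.pairwise_pair.1 hba) ?_
    rwa [area_swap, neg_pos]
  have hra : area r a ξ < 0 :=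
    h.area_neg (hmem x (by simp)) (hmem r (by simp)) (hmem a (by simp)) hr hxa
      (hccw x r a (.trans (by simp) hsub))
  have hnd : [r, b, a].Nodup := hl.nodup.sublist (.trans (by simp) hsub)
  simp only [List.nodup_cons, List.mem_cons, List.not_mem_nil, or_false, not_or] at hnd
  by_contra! hab
  refine ha r (hmem r (by simp)) b (hmem b (by simp)) hnd.1.1 hnd.1.2 hnd.2.1
    (h.meets (hmem a (by simp)) (hmem r (by simp)) (hmem b (by simp)) ?_ ?_ ?_)
  · rw [area_swap_left]
    linarith
  · rw [area_rotate b a]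
    exact hab.lt_of_ne' (h.area_ne_zero (hmem b (by simp)) (hmem a (by simp)) hnd.2.1)
  · rw [← area_rotate]
    exact hccw r b a (.trans (by simp) hsub)

lemma OuterPoint.seesPast_arc_of_ccw (h : OuterPoint C ξ) {a b : Plane} {X Y : List Plane}
    (hl : IsHull C (a :: X ++ b :: Y)) (hccw : CCW (a :: X ++ b :: Y)) (ha : SeesPast ξ C a)
    (hb : SeesPast ξ C b) (hab : 0 < area b a ξ) : ∀ x ∈ X, SeesPast ξ C x := by
  intro x hx
  by_contra hvis
  obtain ⟨X₁, X₂, rfl⟩ := List.append_of_mem hx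
  have hsplit : a :: (X₁ ++ x :: X₂) ++ b :: Y = (a :: X₁) ++ (x :: (X₂ ++ b :: Y)) := by simp
  rw [hsplit] at hl hccw
  have hl' := hl.rotate
  have hxb : x ≠ b := fun e => (List.nodup_cons.1 hl'.nodup).1 (by simp [e])
  refine hab.not_gt ?_
  rcases (h.area_ne_zero ((hl.mem_iff x).1 (by simp)) ((hl.mem_iff b).1 (by simp)) hxb).lt_or_gt
    with hneg | hpos
  · exact h.area_neg_of_hidden_of_neg hl' hccw.rotate hvis ha hneg
  · exact h.area_neg_of_hidden_of_pos hl' hccw.rotate hvis hb hpos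

lemma OuterPoint.exists_visible_arc (h : OuterPoint C ξ) {a b : Plane} (haC : a ∈ C)
    (hbC : b ∈ C) (hab : a ≠ b) (ha : SeesPast ξ C a) (hb : SeesPast ξ C b) :
    ∃ X Y, IsHull C (a :: X ++ b :: Y) ∧ ∀ x ∈ X, SeesPast ξ C x := by
  obtain ⟨l, hl, hccw⟩ := h.exists_hull ⟨a, haC⟩
  obtain ⟨s, t, rfl⟩ := List.append_of_mem ((hl.mem_iff a).2 haC)
  have hl' := hl.rotate
  have hccw' := hccw.rotate
  obtain ⟨X, Y, hXY⟩ := List.append_of_mem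
    ((List.mem_cons.1 ((hl'.mem_iff b).2 hbC)).resolve_left hab.symm)
  rw [List.cons_append, show t ++ s = X ++ b :: Y from hXY, ← List.cons_append] at hl' hccw'
  rcases (h.area_ne_zero haC hbC hab).lt_or_gt with hneg | hpos
  · refine ⟨X, Y, hl', h.seesPast_arc_of_ccw hl' hccw' ha hb ?_⟩
    rwa [area_swap_left, neg_pos]
  · have hY := h.seesPast_arc_of_ccw hl'.rotate hccw'.rotate hb ha hpos
    refine ⟨Y.reverse, X.reverse, ?_, by simpa using hY⟩
    have hrev := (IsHull.rotate (l₁ := [a]) (l₂ := X ++ b :: Y) hl').reverse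
    simpa using hrev

end VisibleArc

section PolygonalPaths

variable {p q : List Plane}

/-- The lists `p` and `q` describe the same polygonal path. -/
def SamePath (p q : List Plane) : Prop := q = p ∨ q = p.reverse

lemma SamePath.linked_iff (h : SamePath p q) (u v : Plane) : Linked u v p ↔ Linked u v q := by
  rcases h with rfl | rfl
  exacts [Iff.rfl, linked_reverse.symm]

lemma SamePath.perm (h : SamePath p q) : q.Perm p := by
  rcases h with rfl | rfl
  exacts [.refl _, List.reverse_perm p]

/-- Segments of the polygonal path through `p` without a common endpoint are disjoint. -/
def NonCrossing (p : List Plane) : Prop :=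
  ∀ a b c d, Consec a b p → Consec c d p → a ≠ c → a ≠ d → b ≠ c → b ≠ d → ¬ Meets a b c d

lemma NonCrossing.not_meets (h : NonCrossing p) {a b c d : Plane} (hab : Linked a b p)
    (hcd : Linked c d p) (hac : a ≠ c) (had : a ≠ d) (hbc : b ≠ c) (hbd : b ≠ d) :
    ¬ Meets a b c d := by
  rcases hab with hab | hab <;> rcases hcd with hcd | hcd
  · exact h a b c d hab hcd hac had hbc hbd
  · exact fun hm => h a b d c hab hcd had hac hbd hbc hm.swap_right
  · exact fun hm => h b a c d hab hcd hbc hbd hac had hm.swap_left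
  · exact fun hm => h b a d c hab hcd hbd hbc had hac hm.swap_left.swap_right

lemma NonCrossing.reverse (h : NonCrossing p) : NonCrossing p.reverse :=
  fun _ _ _ _ hab hcd => h.not_meets (.inr (consec_reverse.1 hab)) (.inr (consec_reverse.1 hcd))

end PolygonalPaths

section PathOf

variable {S : Set Plane} {p q : List Plane}

/-- The graph of the path that visits the entries of the list in order. -/
def pathOf (S : Set Plane) (p : List Plane) : SimpleGraph S where
  Adj u v := Linked (u : Plane) v p ∧ u ≠ v
  symm := ⟨fun _ _ h => ⟨h.1.symm, h.2.symm⟩⟩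
  loopless := ⟨fun _ h => h.2 rfl⟩

lemma SamePath.pathOf_eq (h : SamePath p q) : pathOf S p = pathOf S q := by
  ext u v
  simp only [pathOf, h.linked_iff]

lemma pathOf_reverse (p : List Plane) : pathOf S p.reverse = pathOf S p :=
  (SamePath.pathOf_eq (.inr rfl)).symm

lemma pathOf_append {p₁ p₂ : List Plane} {x y : S} (hx : p₁.getLast? = some (x : Plane))
    (hy : p₂.head? = some (y : Plane)) :
    pathOf S (p₁ ++ p₂) = (pathOf S p₁ ⊔ pathOf S p₂) ⊔ SimpleGraph.edge x y := by
  ext u v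
  simp only [pathOf, SimpleGraph.sup_adj, SimpleGraph.edge_adj, linked_append, hx, hy,
    Option.some.injEq, ← Subtype.ext_iff, eq_comm (a := x), eq_comm (a := y)]
  tauto

lemma pathOf_adj_getElem (hp : p.Nodup) {i j : ℕ} {hi : i < p.length} {hj : j < p.length}
    {hi' : p[i] ∈ S} {hj' : p[j] ∈ S} :
    (pathOf S p).Adj ⟨p[i], hi'⟩ ⟨p[j], hj'⟩ ↔ i + 1 = j ∨ j + 1 = i := by
  simp only [pathOf, Linked, consec_getElem_iff hp, ne_eq, Subtype.mk.injEq, hp.getElem_inj_iff]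
  lia

lemma isSpanningPath_pathOf (hp : p.Nodup) (hS : ∀ x, x ∈ p ↔ x ∈ S) :
    IsSpanningPath (pathOf S p) := by
  let f : Fin p.length → S := fun i => ⟨p[i], (hS _).1 (List.getElem_mem _)⟩
  have hf : Function.Bijective f := by
    refine ⟨fun i j hij => Fin.ext (hp.getElem_inj_iff.1 (congrArg Subtype.val hij)), ?_⟩
    rintro ⟨x, hx⟩
    obtain ⟨i, hi, rfl⟩ := List.getElem_of_mem ((hS x).2 hx)
    exact ⟨⟨i, hi⟩, rfl⟩
  refine ⟨p.length, ⟨⟨Equiv.ofBijective f hf, fun {i j} => ?_⟩⟩⟩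
  rw [SimpleGraph.pathGraph_adj]
  exact pathOf_adj_getElem hp

lemma exists_eq_pathOf_of_isSpanningPath {G : SimpleGraph S} (hG : IsSpanningPath G) :
    ∃ p : List Plane, p.Nodup ∧ (∀ x, x ∈ p ↔ x ∈ S) ∧ G = pathOf S p := by
  obtain ⟨m, ⟨f⟩⟩ := hG
  let p : List Plane := List.ofFn fun i => (f i : Plane)
  have hp : p.Nodup := List.nodup_ofFn.2 fun i j h => f.injective (Subtype.ext h)
  refine ⟨p, hp, fun x => ?_, ?_⟩
  · rw [List.mem_ofFn]
    exact ⟨by rintro ⟨i, rfl⟩; exact (f i).2,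
      fun hx => ⟨f.symm ⟨x, hx⟩, by rw [f.apply_symm_apply]⟩⟩
  · have hget (i : Fin m) : p[(i : ℕ)]'(by simp [p]) = f i := List.getElem_ofFn _
    ext u v
    obtain ⟨i, rfl⟩ := f.surjective u
    obtain ⟨j, rfl⟩ := f.surjective v
    rw [f.map_adj_iff, SimpleGraph.pathGraph_adj, ← pathOf_adj_getElem (S := S) hp
      (hi' := (hget i) ▸ (f i).2) (hj' := (hget j) ▸ (f j).2)]
    simp only [hget]

/-- The list `p` describes a plane path of `S`. -/
structure PlaneList (S : Set Plane) (p : List Plane) : Prop where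
  nodup : p.Nodup
  mem_iff : ∀ x, x ∈ p ↔ x ∈ S
  nonCrossing : NonCrossing p

lemma PlaneList.reverse (h : PlaneList S p) : PlaneList S p.reverse :=
  ⟨List.nodup_reverse.2 h.nodup, fun x => by rw [List.mem_reverse, h.mem_iff],
    h.nonCrossing.reverse⟩

lemma segment_inter_segment_subset (hS : InGeneralPosition S) {a b d : Plane} (ha : a ∈ S)
    (hb : b ∈ S) (hd : d ∈ S) (hab : a ≠ b) (had : a ≠ d) (hbd : b ≠ d) :
    segment ℝ a b ∩ segment ℝ a d ⊆ ({a, b} ∩ {a, d} : Set Plane) :=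
  (segment_inter_segment_subset_of_area_ne (area_ne_zero hS ha hb hd hab had hbd)).trans
    (by simp)

lemma PlaneList.isPlane (hS : InGeneralPosition S) (h : PlaneList S p) : IsPlane (pathOf S p) := by
  intro a b c d ⟨hab, hne⟩ ⟨hcd, hne'⟩ hs
  rw [← Subtype.coe_ne_coe] at hne hne'
  obtain ⟨hac_bd, had_bc⟩ : ((a : Plane) = c → (b : Plane) ≠ d) ∧
      ((a : Plane) = d → (b : Plane) ≠ c) := by
    simpa only [ne_eq, Sym2.eq_iff, not_or, not_and, Subtype.ext_iff] using hs
  by_cases hac : (a : Plane) = c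
  · rw [← hac] at hne' ⊢
    exact segment_inter_segment_subset hS a.2 b.2 d.2 hne hne' (hac_bd hac)
  by_cases had : (a : Plane) = d
  · rw [← had] at hne' ⊢
    rw [segment_symm ℝ (c : Plane), Set.pair_comm (c : Plane)]
    exact segment_inter_segment_subset hS a.2 b.2 c.2 hne hne'.symm (had_bc had)
  rw [segment_symm ℝ (a : Plane), Set.pair_comm (a : Plane)]
  by_cases hbc : (b : Plane) = c
  · rw [← hbc] at hne' ⊢
    exact segment_inter_segment_subset hS b.2 a.2 d.2 hne.symm hne' had
  by_cases hbd : (b : Plane) = d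
  · rw [← hbd] at hne' ⊢
    rw [segment_symm ℝ (c : Plane), Set.pair_comm (c : Plane)]
    exact segment_inter_segment_subset hS b.2 a.2 c.2 hne.symm hne'.symm hac
  · exact fun x hx => absurd ⟨x, hx⟩ (h.nonCrossing.not_meets hab.symm hcd hbc hbd hac had)

lemma exists_planeList (P : PlanePath S) : ∃ p, PlaneList S p ∧ P.1 = pathOf S p := by
  obtain ⟨G, hG, hplane⟩ := P
  obtain ⟨p, hp, hS, rfl⟩ := exists_eq_pathOf_of_isSpanningPath hG
  refine ⟨p, ⟨hp, hS, ?_⟩, rfl⟩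
  rintro a b c d hab hcd hac had hbc hbd ⟨x, hx⟩
  have hmem {y : Plane} (hy : y ∈ p) : y ∈ S := (hS y).1 hy
  obtain ⟨hx₁, hx₂⟩ := hplane ⟨a, hmem hab.mem.1⟩ ⟨b, hmem hab.mem.2⟩ ⟨c, hmem hcd.mem.1⟩
    ⟨d, hmem hcd.mem.2⟩ ⟨.inl hab, Subtype.coe_ne_coe.1 (hab.ne hp)⟩
    ⟨.inl hcd, Subtype.coe_ne_coe.1 (hcd.ne hp)⟩ (by simp [hac, had]) hx
  rcases hx₁ with rfl | rfl <;> rcases hx₂ with rfl | rfl <;> contradiction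

end PathOf

section Flips

variable {S : Set Plane}

lemma ncard_symmDiff_edgeSet_sup_edge {V : Type*} {G : SimpleGraph V} {x y z w : V}
    (hxy : ¬ G.Adj x y) (hzw : ¬ G.Adj z w) (hxy' : x ≠ y) (hzw' : z ≠ w)
    (hne : s(x, y) ≠ s(z, w)) :
    (symmDiff (G ⊔ .edge x y).edgeSet (G ⊔ .edge z w).edgeSet).ncard = 2 := by
  rw [← SimpleGraph.mem_edgeSet] at hxy hzw
  have : symmDiff (G ⊔ .edge x y).edgeSet (G ⊔ .edge z w).edgeSet = {s(x, y), s(z, w)} := by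
    rw [SimpleGraph.edgeSet_sup, SimpleGraph.edgeSet_sup, SimpleGraph.edgeSet_edge_of_ne hxy',
      SimpleGraph.edgeSet_edge_of_ne hzw']
    ext e
    simp only [Set.mem_symmDiff, Set.mem_union, Set.mem_singleton_iff, Set.mem_insert_iff]
    constructor
    · tauto
    · rintro (rfl | rfl)
      exacts [.inl ⟨.inr rfl, by tauto⟩, .inr ⟨.inr rfl, by tauto⟩]
  rw [this, Set.ncard_pair hne]

lemma PlaneList.exists_pathOf_eq_sup_edge {p₁ p₂ q₁ q₂ : List Plane} (hp : PlaneList S (p₁ ++ p₂))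
    (hp₁ : p₁ ≠ []) (hp₂ : p₂ ≠ []) (h₁ : SamePath p₁ q₁) (h₂ : SamePath p₂ q₂) :
    ∃ x y : S, x ≠ y ∧ ¬ (pathOf S p₁ ⊔ pathOf S p₂).Adj x y ∧
      pathOf S (q₁ ++ q₂) = (pathOf S p₁ ⊔ pathOf S p₂) ⊔ .edge x y := by
  have hq₁ : q₁ ≠ [] := fun h => hp₁ (List.nil_perm.1 (h ▸ h₁.perm))
  have hq₂ : q₂ ≠ [] := fun h => hp₂ (List.nil_perm.1 (h ▸ h₂.perm))
  have hx : q₁.getLast hq₁ ∈ p₁ := h₁.perm.subset (List.getLast_mem hq₁)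
  have hy : q₂.head hq₂ ∈ p₂ := h₂.perm.subset (List.head_mem hq₂)
  have hdisj : ∀ a ∈ p₁, ∀ b ∈ p₂, a ≠ b := (List.nodup_append.1 hp.nodup).2.2
  let x : S := ⟨_, (hp.mem_iff _).1 (List.mem_append_left _ hx)⟩
  let y : S := ⟨_, (hp.mem_iff _).1 (List.mem_append_right _ hy)⟩
  refine ⟨x, y, Subtype.coe_ne_coe.1 (hdisj _ hx _ hy), ?_, ?_⟩
  · rintro (h | h)
    exacts [hdisj _ h.1.mem.2 _ hy rfl, hdisj _ hx _ h.1.mem.1 rfl]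
  · rw [pathOf_append (x := x) (y := y) (List.getLast?_eq_some_getLast hq₁)
        (List.head?_eq_some_head hq₂),
      h₁.pathOf_eq, h₂.pathOf_eq]

lemma adj_or_eq_of_samePath {P Q : PlanePath S} {p₁ p₂ q₁ q₂ : List Plane}
    (hp : PlaneList S (p₁ ++ p₂)) (h₁ : SamePath p₁ q₁) (h₂ : SamePath p₂ q₂)
    (hP : P.1 = pathOf S (p₁ ++ p₂)) (hQ : Q.1 = pathOf S (q₁ ++ q₂)) :
    (flipGraph S).Adj P Q ∨ P = Q := by
  rcases eq_or_ne p₁ [] with rfl | hp₁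
  · obtain rfl := List.perm_nil.1 h₁.perm
    exact .inr (Subtype.ext (hP.trans (h₂.pathOf_eq.trans hQ.symm)))
  rcases eq_or_ne p₂ [] with rfl | hp₂
  · obtain rfl := List.perm_nil.1 h₂.perm
    rw [List.append_nil] at hP hQ
    exact .inr (Subtype.ext (hP.trans (h₁.pathOf_eq.trans hQ.symm)))
  obtain ⟨x, y, hxy, hxy', hP'⟩ := hp.exists_pathOf_eq_sup_edge hp₁ hp₂ (.inl rfl) (.inl rfl)
  obtain ⟨z, w, hzw, hzw', hQ'⟩ := hp.exists_pathOf_eq_sup_edge hp₁ hp₂ h₁ h₂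
  rw [hP'] at hP
  rw [hQ'] at hQ
  by_cases hne : s(x, y) = s(z, w)
  · rw [SimpleGraph.edge, hne, ← SimpleGraph.edge] at hP
    exact .inr (Subtype.ext (hP.trans hQ.symm))
  · left
    change (symmDiff P.1.edgeSet Q.1.edgeSet).ncard = 2
    rw [hP, hQ]
    exact ncard_symmDiff_edgeSet_sup_edge hxy' hzw' hxy hzw hne

variable {D : Set (PlanePath S)} {k l : ℕ} {p q r : List Plane}

/-- The list `p` describes a plane path that belongs to `D`. -/
structure PlaneListIn (D : Set (PlanePath S)) (p : List Plane) : Prop extends PlaneList S p where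
  exists_path : ∃ P : D, P.1.1 = pathOf S p

/-- The paths described by `p` and `q` belong to `D` and are at most `k` flips apart, where all
intermediate paths have to be in `D` as well. -/
def FlipReach (D : Set (PlanePath S)) (k : ℕ) (p q : List Plane) : Prop :=
  ∃ P Q : D, P.1.1 = pathOf S p ∧ Q.1.1 = pathOf S q ∧ ((flipGraph S).induce D).edist P Q ≤ k

lemma FlipReach.trans (h : FlipReach D k p q) (h' : FlipReach D l q r) :
    FlipReach D (k + l) p r := by
  obtain ⟨P, Q, hP, hQ, hPQ⟩ := h
  obtain ⟨Q', R, hQ', hR, hQR⟩ := h'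
  obtain rfl : Q = Q' := Subtype.ext (Subtype.ext (hQ.trans hQ'.symm))
  refine ⟨P, R, hP, hR, ?_⟩
  rw [Nat.cast_add]
  exact SimpleGraph.edist_triangle.trans (add_le_add hPQ hQR)

lemma FlipReach.symm (h : FlipReach D k p q) : FlipReach D k q p := by
  obtain ⟨P, Q, hP, hQ, hPQ⟩ := h
  exact ⟨Q, P, hQ, hP, by rwa [SimpleGraph.edist_comm]⟩

lemma FlipReach.mono (h : FlipReach D k p q) (hkl : k ≤ l) : FlipReach D l p q := by
  obtain ⟨P, Q, hP, hQ, hPQ⟩ := h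
  exact ⟨P, Q, hP, hQ, hPQ.trans (Nat.cast_le.2 hkl)⟩

lemma FlipReach.reverse_left (h : FlipReach D k p q) : FlipReach D k p.reverse q := by
  obtain ⟨P, Q, hP, hQ, hPQ⟩ := h
  exact ⟨P, Q, by rw [hP, pathOf_reverse], hQ, hPQ⟩

lemma FlipReach.reverse_right (h : FlipReach D k p q) : FlipReach D k p q.reverse :=
  h.symm.reverse_left.symm

lemma PlaneListIn.refl (h : PlaneListIn D p) : FlipReach D 0 p p := by
  obtain ⟨P, hP⟩ := h.exists_path
  exact ⟨P, P, hP, hP, by simp⟩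

lemma PlaneListIn.reverse (h : PlaneListIn D p) : PlaneListIn D p.reverse := by
  obtain ⟨P, hP⟩ := h.exists_path
  exact ⟨h.toPlaneList.reverse, P, by rw [hP, pathOf_reverse]⟩

lemma PlaneListIn.flip {p₁ p₂ q₁ q₂ : List Plane} (hp : PlaneListIn D (p₁ ++ p₂))
    (hq : PlaneListIn D (q₁ ++ q₂)) (h₁ : SamePath p₁ q₁) (h₂ : SamePath p₂ q₂) :
    FlipReach D 1 (p₁ ++ p₂) (q₁ ++ q₂) := by
  obtain ⟨P, hP⟩ := hp.exists_path
  obtain ⟨Q, hQ⟩ := hq.exists_path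
  refine ⟨P, Q, hP, hQ, SimpleGraph.edist_le_one_iff_adj_or_eq.2 ?_⟩
  exact (adj_or_eq_of_samePath hp.toPlaneList h₁ h₂ hP hQ).imp id Subtype.ext

lemma PlaneListIn.reverse_suffix {p₁ p₂ : List Plane} (hp : PlaneListIn D (p₁ ++ p₂))
    (hq : PlaneListIn D (p₁ ++ p₂.reverse)) :
    FlipReach D (min (p₂.length - 1) 1) (p₁ ++ p₂) (p₁ ++ p₂.reverse) := by
  rcases p₂ with _ | ⟨x, _ | ⟨y, p₂⟩⟩
  · exact hp.refl
  · exact hp.refl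
  · exact (hp.flip hq (.inl rfl) (.inr rfl)).mono (by simp)

lemma PlaneListIn.swap {p₁ p₂ : List Plane} (hp : PlaneListIn D (p₁ ++ p₂))
    (hq : PlaneListIn D (p₂ ++ p₁)) : FlipReach D (min p₁.length 1) (p₁ ++ p₂) (p₂ ++ p₁) := by
  rcases p₁ with _ | ⟨x, p₁⟩
  · simpa using hp.refl
  · have hq' := hq.reverse
    rw [List.reverse_append] at hq'
    simpa using (hp.flip hq' (.inr rfl) (.inr rfl)).reverse_right

lemma PlaneListIn.swap_reverse {p₁ p₂ : List Plane} (hp : PlaneListIn D (p₁ ++ p₂))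
    (hq : PlaneListIn D (p₂ ++ p₁.reverse)) :
    FlipReach D (min p₁.length 1) (p₁ ++ p₂) (p₂ ++ p₁.reverse) := by
  rcases p₁ with _ | ⟨x, p₁⟩
  · simpa using hp.refl
  · have hq' := hq.reverse
    rw [List.reverse_append, List.reverse_reverse] at hq'
    simpa using (hp.flip hq' (.inl rfl) (.inr rfl)).reverse_right

/-- Every zigzag through `l` yields, when appended to `p₀`, a plane path in `D`. -/
def AllZigs (D : Set (PlanePath S)) (p₀ l : List Plane) : Prop :=
  ∀ w, Zig l w → PlaneListIn D (p₀ ++ w)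

lemma AllZigs.tail {p₀ l : List Plane} {x : Plane} (h : AllZigs D p₀ (x :: l)) :
    AllZigs D (p₀ ++ [x]) l :=
  fun w hw => by simpa using h _ (hw.head x)

lemma AllZigs.dropLast {p₀ l : List Plane} {x : Plane} (h : AllZigs D p₀ (l ++ [x])) :
    AllZigs D (p₀ ++ [x]) l :=
  fun w hw => by simpa using h _ (hw.last x)

lemma AllZigs.reverse {p₀ l : List Plane} (h : AllZigs D p₀ l) : AllZigs D p₀ l.reverse :=
  fun w hw => h w (by simpa using hw.reverse_left)

lemma AllZigs.flipReach_self_reverse {p₀ l : List Plane} (h : AllZigs D p₀ l) :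
    FlipReach D (min (l.length - 1) 1) (p₀ ++ l) (p₀ ++ l.reverse) :=
  (h _ (zig_self l)).reverse_suffix (h _ (zig_reverse l))

lemma Zig.flipReach {p₀ l w : List Plane} (hw : Zig l w) (h : AllZigs D p₀ l) :
    FlipReach D (l.length - 1) (p₀ ++ w) (p₀ ++ l) ∧
      FlipReach D (l.length - 1) (p₀ ++ w) (p₀ ++ l.reverse) := by
  induction hw generalizing p₀ with
  | nil => exact ⟨(h [] .nil).refl, (h [] .nil).refl⟩
  | @head x l w _ ih =>
    have hl : FlipReach D (l.length - 1) (p₀ ++ x :: w) (p₀ ++ x :: l) := by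
      simpa using (ih h.tail).1
    exact ⟨hl.mono (by simp), (hl.trans h.flipReach_self_reverse).mono (by simp)⟩
  | @last x l w _ ih =>
    have hl : FlipReach D (l.length - 1) (p₀ ++ x :: w) (p₀ ++ (l ++ [x]).reverse) := by
      simpa using (ih h.dropLast).2
    exact ⟨(hl.trans h.flipReach_self_reverse.symm).mono (by simp), hl.mono (by simp)⟩

end Flips

section Turns

variable {S : Set Plane} {D : Set (PlanePath S)} {p₀ l w : List Plane}

lemma ZigHead.flipReach (hw : ZigHead l w) (h : AllZigs D p₀ l) :
    FlipReach D (l.length - 2) (p₀ ++ w) (p₀ ++ l) := by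
  obtain ⟨x, l, w, rfl, rfl, hw⟩ := hw
  simpa using (hw.flipReach h.tail).1

lemma Zig.flipReach_turn {X Y : List Plane} (hw : Zig (Y ++ X) w) (h : AllZigs D p₀ (Y ++ X))
    (hY : Y = [] ∨ ZigHead (Y ++ X) w) :
    FlipReach D ((Y ++ X).length - 1) (p₀ ++ w) (p₀ ++ (Y ++ X.reverse)) := by
  rcases hY with rfl | hhead
  · exact (hw.flipReach h).2
  rcases Y with _ | ⟨y, Y⟩
  · exact (hw.flipReach h).2
  have h₁ := h _ (zig_self _)
  have h₂ := h _ ((zig_reverse X).prepend (y :: Y))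
  rw [← List.append_assoc] at h₁ h₂
  have hturn := h₁.reverse_suffix h₂
  rw [List.append_assoc, List.append_assoc] at hturn
  exact ((hhead.flipReach h).trans hturn).mono (by simp; lia)

end Turns

section ConvexPosition

variable {I J l w : List Plane}

lemma NonCrossing.cons {a : Plane} (hw : NonCrossing w)
    (h : ∀ x ∈ w.head?, ∀ c d, Consec c d w → x ≠ c → x ≠ d → ¬ Meets a x c d) :
    NonCrossing (a :: w) := by
  intro s t c d hst hcd hsc hsd htc htd hm
  rw [consec_cons] at hst hcd
  rcases hst with ⟨rfl, ht⟩ | hst <;> rcases hcd with ⟨rfl, hd⟩ | hcd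
  · exact hsc rfl
  · exact h t ht c d hcd htc htd hm
  · exact h d hd s t hst hsd.symm htd.symm hm.symm
  · exact hw s t c d hst hcd hsc hsd htc htd hm

lemma NonCrossing.of_cons {a : Plane} (h : NonCrossing (a :: w)) : NonCrossing w :=
  fun s t c d hst hcd => h s t c d (consec_cons.2 (.inr hst)) (consec_cons.2 (.inr hcd))

lemma CyclicOrder.not_meets_append (h : CyclicOrder (I ++ J)) {s t u v : Plane} (hs : s ∈ I)
    (ht : t ∈ I) (hst : s ≠ t) (hu : u ∈ J) (hv : v ∈ J) (huv : u ≠ v) : ¬ Meets s t u v := by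
  have key {s t u v : Plane} (hst : [s, t].Sublist I) (huv : [u, v].Sublist J) :
      ¬ Meets s t u v := (h.sublist (hst.append huv)).sides_diagonals.1
  rcases pair_sublist_or hs ht hst with hst | hst <;>
    rcases pair_sublist_or hu hv huv with huv | huv
  · exact key hst huv
  · exact fun hm => key hst huv hm.swap_right
  · exact fun hm => key hst huv hm.swap_left
  · exact fun hm => key hst huv hm.swap_left.swap_right

lemma Zig.nonCrossing_cons {a : Plane} (hw : Zig l w) (hc : CyclicOrder (a :: l))
    (hn : (a :: l).Nodup) (h : NonCrossing w) : NonCrossing (a :: w) := by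
  refine h.cons fun y hy c d hcd hyc hyd => ?_
  have hne := hcd.ne (hw.perm.nodup_iff.2 hn.of_cons)
  obtain ⟨hcl, hdl⟩ := hcd.mem
  rw [hw.perm.mem_iff] at hcl hdl
  rcases hw.eq_nil_or_zigHead_or_zigLast with
    ⟨rfl, rfl⟩ | ⟨x, l, w, rfl, rfl, -⟩ | ⟨x, l, w, rfl, rfl, -⟩
  · simp at hy
  · obtain rfl : x = y := by simpa using hy
    exact CyclicOrder.not_meets_append (I := [a, x]) hc (by simp) (by simp)
      (fun e => hn.notMem (by simp [e])) (List.mem_of_ne_of_mem hyc.symm hcl)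
      (List.mem_of_ne_of_mem hyd.symm hdl) hne
  · obtain rfl : x = y := by simpa using hy
    have hc' : CyclicOrder ([x, a] ++ l) := CyclicOrder.rotate (l₁ := a :: l) (l₂ := [x]) hc
    refine fun hm => hc'.not_meets_append (by simp) (by simp) (fun e => hn.notMem (by simp [e]))
      ?_ ?_ hne hm.swap_left
    · simpa [hyc.symm] using hcl
    · simpa [hyd.symm] using hdl

lemma Zig.nonCrossing (hw : Zig l w) (hc : CyclicOrder l) (hn : l.Nodup) : NonCrossing w := by
  induction hw with
  | nil => exact fun a b _ _ hab => absurd hab (not_consec_nil a b)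
  | head x hw ih =>
    exact hw.nonCrossing_cons hc hn (ih (hc.sublist (List.sublist_cons_self _ _)) hn.of_cons)
  | @last x l w hw ih =>
    have hn' : (x :: l).Nodup := (List.perm_append_singleton x l).nodup_iff.1 hn
    exact hw.nonCrossing_cons (CyclicOrder.rotate hc) hn'
      (ih (hc.sublist (List.sublist_append_left _ _)) hn'.of_cons)

lemma NonCrossing.eq_nil_or_eq_nil {a x : Plane} {l₁ l₂ : List Plane}
    (h : NonCrossing (a :: x :: w)) (hp : w.Perm (l₁ ++ l₂))
    (hc : CyclicOrder (a :: (l₁ ++ x :: l₂))) (hn : (a :: x :: (l₁ ++ l₂)).Nodup) :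
    l₁ = [] ∨ l₂ = [] := by
  by_contra! hne
  obtain ⟨u, hu⟩ := List.exists_mem_of_ne_nil _ hne.1
  obtain ⟨v, hv⟩ := List.exists_mem_of_ne_nil _ hne.2
  simp only [List.nodup_cons, List.mem_cons, List.mem_append, not_or] at hn
  obtain ⟨⟨-, ha₁, ha₂⟩, ⟨hx₁, hx₂⟩, hn⟩ := hn
  have hdisj : v ∉ l₁ := fun hv' => List.disjoint_of_nodup_append hn hv' hv
  obtain ⟨c, d, hcd, hc₁, hd₁⟩ := exists_linked_of_mem (· ∈ l₁)
    (hp.mem_iff.2 (List.mem_append_left _ hu)) (hp.mem_iff.2 (List.mem_append_right _ hv)) hu hdisj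
  have hd₂ : d ∈ l₂ := (List.mem_append.1 (hp.mem_iff.1 hcd.mem.2)).resolve_left hd₁
  have hsub : [a, c, x, d].Sublist (a :: (l₁ ++ x :: l₂)) :=
    ((List.singleton_sublist.2 hc₁).append ((List.singleton_sublist.2 hd₂).cons_cons x)).cons_cons a
  refine h.not_meets (.inl ⟨[], w, rfl⟩) ?_ (fun e => ha₁ (e ▸ hc₁)) (fun e => ha₂ (e ▸ hd₂))
    (fun e => hx₁ (e ▸ hc₁)) (fun e => hx₂ (e ▸ hd₂)) (hc.sublist hsub).sides_diagonals.2.2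
  exact linked_append (l₁ := [a, x]).2 (.inr (.inl hcd))

lemma NonCrossing.zig {a : Plane} (h : NonCrossing (a :: w)) (hp : w.Perm l)
    (hc : CyclicOrder (a :: l)) (hn : (a :: l).Nodup) : Zig l w := by
  induction w generalizing a l with
  | nil => rw [← hp.nil_eq]; exact .nil
  | cons x w ih =>
    obtain ⟨l₁, l₂, rfl⟩ := List.append_of_mem (hp.mem_iff.1 List.mem_cons_self)
    have hp' : w.Perm (l₁ ++ l₂) := (hp.trans List.perm_middle).cons_inv
    have hc' : CyclicOrder (l₁ ++ x :: l₂) := hc.sublist (List.sublist_cons_self _ _)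
    have hn' : (a :: x :: (l₁ ++ l₂)).Nodup := (List.perm_middle.cons a).nodup_iff.1 hn
    rcases h.eq_nil_or_eq_nil hp' hc hn' with rfl | rfl
    · exact (ih h.of_cons hp' hc' hn'.of_cons).head x
    · rw [List.append_nil] at hp' hn'
      exact (ih h.of_cons hp' hc'.rotate hn'.of_cons).last x

/-- `p` is a zigzag through a rotation of the list `I`. If the entries of `I` are in cyclic order,
then these are the plane paths through the entries of `I`. -/
def PathOn (I p : List Plane) : Prop := ∃ Y X, I = Y ++ X ∧ Zig (X ++ Y) p

lemma Zig.pathOn {Y X : List Plane} (h : Zig (X ++ Y) w) : PathOn (Y ++ X) w := ⟨Y, X, rfl, h⟩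

lemma pathOn_cons_iff {a : Plane} :
    PathOn I (a :: w) ↔ ∃ Y X, I = Y ++ a :: X ∧ Zig (X ++ Y) w := by
  constructor
  · rintro ⟨Y, X, rfl, hz⟩
    rcases hz.eq_nil_or_zigHead_or_zigLast with
      ⟨-, h⟩ | ⟨x, l, w, hl, h, hw⟩ | ⟨x, l, w, hl, h, hw⟩
    · simp at h
    · obtain ⟨rfl, rfl⟩ := List.cons.inj h
      rcases X with _ | ⟨b, X⟩
      · exact ⟨[], l, by simpa using hl, by simpa using hw⟩
      · obtain ⟨rfl, rfl⟩ := List.cons.inj hl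
        exact ⟨Y, X, rfl, hw⟩
    · obtain ⟨rfl, rfl⟩ := List.cons.inj h
      rcases Y.eq_nil_or_concat' with rfl | ⟨Y, b, rfl⟩
      · exact ⟨l, [], by simpa using hl, by simpa using hw⟩
      · rw [← List.append_assoc] at hl
        obtain ⟨rfl, hb⟩ := List.append_inj' hl rfl
        obtain rfl := List.singleton_inj.1 hb
        exact ⟨Y, X, by simp, hw⟩
  · rintro ⟨Y, X, rfl, hz⟩
    exact (hz.head a).pathOn

lemma pathOn_self (I : List Plane) : PathOn I I := ⟨[], I, rfl, by simpa using zig_self I⟩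

lemma pathOn_reverse (I : List Plane) : PathOn I I.reverse :=
  ⟨[], I, rfl, by simpa using zig_reverse I⟩

lemma PathOn.perm (h : PathOn I w) : w.Perm I := by
  obtain ⟨Y, X, rfl, hz⟩ := h
  exact hz.perm.trans List.perm_append_comm

lemma PathOn.nonCrossing (h : PathOn I w) (hc : CyclicOrder I) (hn : I.Nodup) :
    NonCrossing w := by
  obtain ⟨Y, X, rfl, hz⟩ := h
  exact hz.nonCrossing hc.rotate (List.perm_append_comm.nodup_iff.1 hn)

end ConvexPosition

section Join

/-- The path that arrives at `ξ` along the reverse of `A` and continues along `B`. -/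
def join (ξ : Plane) (A B : List Plane) : List Plane := A.reverse ++ ξ :: B

variable {C S : Set Plane} {ξ : Plane} {A B : List Plane}

lemma join_reverse (ξ : Plane) (A B : List Plane) : (join ξ A B).reverse = join ξ B A := by
  simp [join]

lemma join_cons_right (ξ b : Plane) (A B : List Plane) :
    join ξ A (b :: B) = A.reverse ++ [ξ, b] ++ B := by
  simp [join]

lemma join_perm (ξ : Plane) (A B : List Plane) : (join ξ A B).Perm (ξ :: (A ++ B)) :=
  List.perm_middle.trans (((List.reverse_perm A).append_right B).cons ξ)

lemma consec_join {a b : Plane} : Consec a b (join ξ A B) ↔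
    Consec b a A ∨ Consec a b B ∨ (A.head? = some a ∧ b = ξ) ∨ (a = ξ ∧ B.head? = some b) := by
  unfold join
  rw [consec_append, consec_reverse, consec_cons, List.getLast?_reverse]
  simp only [List.head?_cons, Option.some.injEq, eq_comm (a := ξ)]
  tauto

lemma nonCrossing_join (hA : NonCrossing A) (hB : NonCrossing B)
    (hAB : ∀ a b c d, Consec a b A → Consec c d B → ¬ Meets a b c d)
    (hξA : ∀ a, (A.head? = some a ∨ B.head? = some a) → ∀ c d, Consec c d A → c ≠ a → d ≠ a →
      ¬ Meets ξ a c d)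
    (hξB : ∀ a, (A.head? = some a ∨ B.head? = some a) → ∀ c d, Consec c d B → c ≠ a → d ≠ a →
      ¬ Meets ξ a c d) :
    NonCrossing (join ξ A B) := by
  intro a b c d hab hcd hac had hbc hbd hm
  rw [consec_join] at hab hcd
  rcases hab with hab | hab | ⟨hab, rfl⟩ | ⟨rfl, hab⟩ <;>
    rcases hcd with hcd | hcd | ⟨hcd, rfl⟩ | ⟨rfl, hcd⟩
  · exact hA b a d c hab hcd hbd hbc had hac hm.swap_left.swap_right
  · exact hAB b a c d hab hcd hm.swap_left
  · exact hξA c (.inl hcd) b a hab hbc hac hm.symm.swap_left.swap_right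
  · exact hξA d (.inr hcd) b a hab hbd had hm.symm.swap_right
  · exact hAB d c a b hcd hab hm.symm.swap_left
  · exact hB a b c d hab hcd hac had hbc hbd hm
  · exact hξB c (.inl hcd) a b hab hac hbc hm.symm.swap_left
  · exact hξB d (.inr hcd) a b hab had hbd hm.symm
  · exact hξA a (.inl hab) d c hcd had.symm hac.symm hm.swap_left.swap_right
  · exact hξB a (.inl hab) c d hcd hac.symm had.symm hm.swap_left
  · exact hbd rfl
  · exact hbc rfl
  · exact hξA b (.inr hab) d c hcd hbd.symm hbc.symm hm.swap_right
  · exact hξB b (.inr hab) c d hcd hbc.symm hbd.symm hm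
  · exact had rfl
  · exact hac rfl

lemma planeList_join (hξ : ξ ∉ C) {I J : List Plane} (hI : IsHull C (I ++ J))
    (hA : PathOn I A) (hB : PathOn J B)
    (hsee : ∀ a, (A.head? = some a ∨ B.head? = some a) →
      SeesPast ξ {x | x ∈ I} a ∧ SeesPast ξ {x | x ∈ J} a) :
    PlaneList (insert ξ C) (join ξ A B) := by
  obtain ⟨hnI, hnJ, -⟩ := List.nodup_append.1 hI.nodup
  have hmA {c d : Plane} (hcd : Consec c d A) : c ∈ I ∧ d ∈ I ∧ c ≠ d :=
    ⟨hA.perm.subset hcd.mem.1, hA.perm.subset hcd.mem.2, hcd.ne (hA.perm.nodup_iff.2 hnI)⟩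
  have hmB {c d : Plane} (hcd : Consec c d B) : c ∈ J ∧ d ∈ J ∧ c ≠ d :=
    ⟨hB.perm.subset hcd.mem.1, hB.perm.subset hcd.mem.2, hcd.ne (hB.perm.nodup_iff.2 hnJ)⟩
  have hperm : (join ξ A B).Perm (ξ :: (I ++ J)) :=
    (join_perm ξ A B).trans ((hA.perm.append hB.perm).cons ξ)
  refine ⟨?_, fun x => ?_, nonCrossing_join ?_ ?_ ?_ ?_ ?_⟩
  · rw [hperm.nodup_iff, List.nodup_cons, hI.mem_iff]
    exact ⟨hξ, hI.nodup⟩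
  · rw [hperm.mem_iff, List.mem_cons, hI.mem_iff, Set.mem_insert_iff]
  · exact hA.nonCrossing (hI.cyclic.sublist (List.sublist_append_left _ _)) hnI
  · exact hB.nonCrossing (hI.cyclic.sublist (List.sublist_append_right _ _)) hnJ
  · intro a b c d hab hcd
    obtain ⟨⟨ha, hb, hab⟩, hc, hd, hcd⟩ := And.intro (hmA hab) (hmB hcd)
    exact hI.cyclic.not_meets_append ha hb hab hc hd hcd
  · intro a ha c d hcd
    obtain ⟨hc, hd, hne⟩ := hmA hcd
    exact (hsee a ha).1 c hc d hd hne
  · intro a ha c d hcd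
    obtain ⟨hc, hd, hne⟩ := hmB hcd
    exact (hsee a ha).2 c hc d hd hne

lemma image_neighborSet_pathOf {p : List Plane} (hp : PlaneList S p) (x : S) :
    Subtype.val '' (pathOf S p).neighborSet x = {y | Linked (x : Plane) y p} := by
  ext y
  constructor
  · rintro ⟨y, hy, rfl⟩
    exact hy.1
  · exact fun hy => ⟨⟨y, (hp.mem_iff y).1 hy.mem.2⟩,
      ⟨hy, fun e => hy.ne hp.nodup (congrArg Subtype.val e)⟩, rfl⟩

lemma linked_join_iff (hn : (join ξ A B).Nodup) {y : Plane} :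
    Linked ξ y (join ξ A B) ↔ A.head? = some y ∨ B.head? = some y := by
  rw [(join_perm ξ A B).nodup_iff, List.nodup_cons, List.mem_append, not_or] at hn
  have hA {y : Plane} : ¬ Consec ξ y A ∧ ¬ Consec y ξ A :=
    ⟨fun h => hn.1.1 h.mem.1, fun h => hn.1.1 h.mem.2⟩
  have hB {y : Plane} : ¬ Consec ξ y B ∧ ¬ Consec y ξ B :=
    ⟨fun h => hn.1.2 h.mem.1, fun h => hn.1.2 h.mem.2⟩
  have hA' : A.head? ≠ some ξ := fun h => hn.1.1 (List.mem_of_head? h)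
  have hB' : B.head? ≠ some ξ := fun h => hn.1.2 (List.mem_of_head? h)
  simp only [Linked, consec_join, hA, hB, hA', hB', false_or, false_and, true_and, and_true,
    and_false, or_false]
  exact or_comm

lemma ncard_neighborSet_join (hξ : ξ ∈ S) (hp : PlaneList S (join ξ A B)) :
    ((pathOf S (join ξ A B)).neighborSet ⟨ξ, hξ⟩).ncard =
      {y | A.head? = some y ∨ B.head? = some y}.ncard := by
  rw [← Set.ncard_image_of_injective _ Subtype.val_injective, image_neighborSet_pathOf hp]
  simp only [linked_join_iff hp.nodup]

lemma ncard_neighborSet_of_ne_nil (hξ : ξ ∈ S) (hp : PlaneList S (join ξ A B)) (hA : A ≠ [])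
    (hB : B ≠ []) : ((pathOf S (join ξ A B)).neighborSet ⟨ξ, hξ⟩).ncard = 2 := by
  rw [ncard_neighborSet_join hξ hp]
  obtain ⟨a, A, rfl⟩ := List.exists_cons_of_ne_nil hA
  obtain ⟨b, B, rfl⟩ := List.exists_cons_of_ne_nil hB
  have hn := ((join_perm ξ _ _).nodup_iff.1 hp.nodup).of_cons
  have hab : a ≠ b := fun e => hn.notMem (by simp [e])
  rw [← Set.ncard_pair hab]
  congr 1
  ext y
  simp [eq_comm]

lemma ncard_neighborSet_of_nil (hξ : ξ ∈ S) (hp : PlaneList S (join ξ [] B)) (hB : B ≠ []) :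
    ((pathOf S (join ξ [] B)).neighborSet ⟨ξ, hξ⟩).ncard = 1 := by
  rw [ncard_neighborSet_join hξ hp]
  obtain ⟨b, B, rfl⟩ := List.exists_cons_of_ne_nil hB
  rw [← Set.ncard_singleton b]
  congr 1
  ext y
  simp [eq_comm]

end Join

section JoinFlips

variable {S : Set Plane} {ξ : Plane} {D : Set (PlanePath S)} {k : ℕ} {A B A' B' M : List Plane}

lemma PlaneListIn.join_comm (h : PlaneListIn D (join ξ A B)) : PlaneListIn D (join ξ B A) := by
  rw [← join_reverse]
  exact h.reverse

lemma FlipReach.join_comm_left {q : List Plane} (h : FlipReach D k (join ξ A B) q) :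
    FlipReach D k (join ξ B A) q := by
  rw [← join_reverse]
  exact h.reverse_left

lemma FlipReach.join_comm_right {p : List Plane} (h : FlipReach D k p (join ξ A B)) :
    FlipReach D k p (join ξ B A) :=
  h.symm.join_comm_left.symm

lemma PlaneListIn.join_reverse_suffix (hp : PlaneListIn D (join ξ A (B ++ M)))
    (hq : PlaneListIn D (join ξ A (B ++ M.reverse))) :
    FlipReach D (min (M.length - 1) 1) (join ξ A (B ++ M)) (join ξ A (B ++ M.reverse)) := by
  have (M : List Plane) : join ξ A (B ++ M) = join ξ A B ++ M := by simp [join]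
  rw [this] at hp hq ⊢
  rw [this]
  exact hp.reverse_suffix hq

lemma PlaneListIn.join_reverse_right (hp : PlaneListIn D (join ξ A B))
    (hq : PlaneListIn D (join ξ A B.reverse)) :
    FlipReach D (min (B.length - 1) 1) (join ξ A B) (join ξ A B.reverse) :=
  join_reverse_suffix (B := []) hp hq

lemma PlaneListIn.join_reverse_left (hp : PlaneListIn D (join ξ A B))
    (hq : PlaneListIn D (join ξ A.reverse B)) :
    FlipReach D (min (A.length - 1) 1) (join ξ A B) (join ξ A.reverse B) :=
  (hp.join_comm.join_reverse_right hq.join_comm).join_comm_left.join_comm_right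

lemma PlaneListIn.join_move (hp : PlaneListIn D (join ξ (A ++ M) B))
    (hq : PlaneListIn D (join ξ A (B ++ M))) :
    FlipReach D (min M.length 1) (join ξ (A ++ M) B) (join ξ A (B ++ M)) := by
  have h₁ : join ξ (A ++ M) B = M.reverse ++ join ξ A B := by simp [join]
  have h₂ : join ξ A (B ++ M) = join ξ A B ++ M.reverse.reverse := by simp [join]
  rw [h₁] at hp ⊢
  rw [h₂] at hq ⊢
  simpa only [List.length_reverse] using hp.swap_reverse hq

lemma PlaneListIn.join_move_reverse (hp : PlaneListIn D (join ξ A (B ++ M)))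
    (hq : PlaneListIn D (join ξ (A ++ M.reverse) B)) :
    FlipReach D (min M.length 1) (join ξ A (B ++ M)) (join ξ (A ++ M.reverse) B) := by
  have h₁ : join ξ A (B ++ M) = join ξ A B ++ M := by simp [join]
  have h₂ : join ξ (A ++ M.reverse) B = M ++ join ξ A B := by simp [join]
  rw [h₁] at hp ⊢
  rw [h₂] at hq ⊢
  exact (hq.swap hp).symm

/-- The paths that arrive at `ξ` along a zigzag through `l` ending in `a` and leave it through `b`
along a zigzag through `l'` are all plane paths in `D`. -/
def JoinZigs (D : Set (PlanePath S)) (ξ a b : Plane) (l l' : List Plane) : Prop :=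
  ∀ u u', Zig l u → Zig l' u' → PlaneListIn D (join ξ (a :: u) (b :: u'))

variable {a b : Plane} {l l' u w w' : List Plane}

lemma JoinZigs.symm (h : JoinZigs D ξ a b l l') : JoinZigs D ξ b a l' l :=
  fun u u' hu hu' => (h u' u hu' hu).join_comm

lemma JoinZigs.flipReach_right (h : JoinZigs D ξ a b l l') (hu : Zig l u)
    (hw : ∀ p₀, AllZigs D p₀ l' → FlipReach D k (p₀ ++ w) (p₀ ++ w')) :
    FlipReach D k (join ξ (a :: u) (b :: w)) (join ξ (a :: u) (b :: w')) := by
  rw [join_cons_right, join_cons_right]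
  refine hw _ fun u' hu' => ?_
  rw [← join_cons_right]
  exact h u u' hu hu'

lemma JoinZigs.flipReach_left (h : JoinZigs D ξ a b l l') (hu : Zig l' u)
    (hw : ∀ p₀, AllZigs D p₀ l → FlipReach D k (p₀ ++ w) (p₀ ++ w')) :
    FlipReach D k (join ξ (a :: w) (b :: u)) (join ξ (a :: w') (b :: u)) :=
  (h.symm.flipReach_right hu hw).join_comm_left.join_comm_right

end JoinFlips

section Detours

variable {C : Set Plane} {ξ : Plane} {D : Set (PlanePath (insert ξ C))} {k m : ℕ}
  {P Q P' Q' A B I J : List Plane}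

/-- Every plane path with `ξ` in its interior belongs to `D`. -/
def AdmitsInner (D : Set (PlanePath (insert ξ C))) : Prop :=
  ∀ A B, A ≠ [] → B ≠ [] → PlaneList (insert ξ C) (join ξ A B) → PlaneListIn D (join ξ A B)

lemma AdmitsInner.planeListIn (hD : AdmitsInner D) (hξ : ξ ∉ C) (hI : IsHull C (I ++ J))
    (hA : PathOn I A) (hB : PathOn J B) (hA' : A ≠ []) (hB' : B ≠ []) (ha : HeadVisible C ξ A)
    (hb : HeadVisible C ξ B) : PlaneListIn D (join ξ A B) := by
  refine hD A B hA' hB' (planeList_join hξ hI hA hB fun c hc => ?_)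
  have hvis : SeesPast ξ C c := hc.elim (ha c) (hb c)
  exact ⟨hvis.mono fun x hx => (hI.mem_iff x).1 (List.mem_append_left _ hx),
    hvis.mono fun x hx => (hI.mem_iff x).1 (List.mem_append_right _ hx)⟩

/-- `Q ++ P` lists `C` in cyclic order, from one point visible from `ξ` to another one. The path
`P ++ ξ :: Q` then traverses the boundary of the convex hull of `C`, with a detour to `ξ`. -/
structure HullDetour (C : Set Plane) (ξ : Plane) (P Q : List Plane) : Prop where
  hull : IsHull C (Q ++ P)
  left_ne : P ≠ []
  right_ne : Q ≠ []
  head_visible : HeadVisible C ξ (Q ++ P)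
  last_visible : HeadVisible C ξ (Q ++ P).reverse

lemma HullDetour.of_append_eq (h : HullDetour C ξ P Q) (hP' : P' ≠ []) (hQ' : Q' ≠ [])
    (he : Q ++ P = Q' ++ P') : HullDetour C ξ P' Q' :=
  ⟨he ▸ h.hull, hP', hQ', he ▸ h.head_visible, he ▸ h.last_visible⟩

lemma HullDetour.reverse (h : HullDetour C ξ P Q) : HullDetour C ξ Q.reverse P.reverse where
  hull := by simpa using h.hull.reverse
  left_ne := List.reverse_ne_nil_iff.2 h.right_ne
  right_ne := List.reverse_ne_nil_iff.2 h.left_ne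
  head_visible := by simpa using h.last_visible
  last_visible := by simpa using h.head_visible

lemma HullDetour.right_visible (h : HullDetour C ξ P Q) : HeadVisible C ξ Q :=
  h.head_visible.of_append h.right_ne

lemma HullDetour.left_visible (h : HullDetour C ξ P Q) : HeadVisible C ξ P.reverse :=
  h.reverse.right_visible

lemma join_reverse_left_eq (ξ : Plane) (P Q : List Plane) : join ξ P.reverse Q = P ++ ξ :: Q := by
  simp [join]

lemma HullDetour.planeListIn (h : HullDetour C ξ P Q) (hD : AdmitsInner D) (hξ : ξ ∉ C)
    (hA : PathOn P A) (hB : PathOn Q B) (hA' : HeadVisible C ξ A) (hB' : HeadVisible C ξ B) :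
    PlaneListIn D (join ξ A B) :=
  hD.planeListIn hξ h.hull.rotate hA hB (fun e => h.left_ne (List.nil_perm.1 (e ▸ hA.perm)))
    (fun e => h.right_ne (List.nil_perm.1 (e ▸ hB.perm))) hA' hB'

lemma HullDetour.planeListIn_self (h : HullDetour C ξ P Q) (hD : AdmitsInner D) (hξ : ξ ∉ C) :
    PlaneListIn D (P ++ ξ :: Q) := by
  rw [← join_reverse_left_eq]
  exact h.planeListIn hD hξ (pathOn_reverse P) (pathOn_self Q) h.left_visible h.right_visible

lemma HullDetour.flipReach_swap (h : HullDetour C ξ P Q) (h' : HullDetour C ξ Q P)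
    (hD : AdmitsInner D) (hξ : ξ ∉ C) : FlipReach D 2 (P ++ ξ :: Q) (Q ++ ξ :: P) := by
  have h₁ := h.planeListIn hD hξ (pathOn_reverse P) (pathOn_self Q) h.left_visible h.right_visible
  have h₂ := h.planeListIn hD hξ (pathOn_reverse P) (pathOn_reverse Q) h.left_visible
    h'.left_visible
  have h₃ := h.planeListIn hD hξ (pathOn_self P) (pathOn_reverse Q) h'.right_visible
    h'.left_visible
  have h₃' := h₃
  rw [← List.reverse_reverse P] at h₃'
  have := ((h₁.join_reverse_right h₂).trans (h₂.join_reverse_left h₃')).join_comm_right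
  rw [List.reverse_reverse, join_reverse_left_eq, join_reverse_left_eq] at this
  exact this.mono (by lia)

lemma HullDetour.flipReach_of_append_eq (h : HullDetour C ξ P Q) (h' : HullDetour C ξ P' Q')
    (hD : AdmitsInner D) (hξ : ξ ∉ C) (he : Q ++ P = Q' ++ P') :
    FlipReach D 1 (P ++ ξ :: Q) (P' ++ ξ :: Q') := by
  have hp := h.planeListIn_self hD hξ
  have hp' := h'.planeListIn_self hD hξ
  rcases List.append_eq_append_iff.1 he with ⟨Z, rfl, rfl⟩ | ⟨Z, rfl, rfl⟩
  · rw [List.append_assoc] at hp ⊢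
    have hp'' : PlaneListIn D (P' ++ ξ :: Q ++ Z) := by simpa using hp'
    simpa using (hp.swap hp'').mono (min_le_right _ _)
  · rw [List.append_assoc] at hp' ⊢
    have hp'' : PlaneListIn D (P ++ ξ :: Q' ++ Z) := by simpa using hp
    simpa using ((hp'.swap hp'').mono (min_le_right _ _)).symm

lemma HullDetour.flipReach_of_ccw (h : HullDetour C ξ P Q) (h' : HullDetour C ξ P' Q')
    (hD : AdmitsInner D) (hξ : ξ ∉ C) (hc : CCW (Q ++ P)) (hc' : CCW (Q' ++ P')) :
    FlipReach D 4 (P ++ ξ :: Q) (P' ++ ξ :: Q') := by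
  obtain ⟨M, N, he, he'⟩ := hc.isRotated hc' h.hull h'.hull
  rcases eq_or_ne M [] with rfl | hM
  · exact (h.flipReach_of_append_eq h' hD hξ (by simp [he, he'])).mono (by lia)
  rcases eq_or_ne N [] with rfl | hN
  · exact (h.flipReach_of_append_eq h' hD hξ (by simp [he, he'])).mono (by lia)
  have hMN := h.of_append_eq hN hM he
  have hNM := h'.of_append_eq hM hN he'
  exact ((h.flipReach_of_append_eq hMN hD hξ he).trans (hMN.flipReach_swap hNM hD hξ)).trans
    (hNM.flipReach_of_append_eq h' hD hξ he'.symm)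

lemma HullDetour.exists_ccw (h : HullDetour C ξ P Q) : ∃ P' Q', HullDetour C ξ P' Q' ∧
    CCW (Q' ++ P') ∧ SamePath (P ++ ξ :: Q) (P' ++ ξ :: Q') := by
  rcases h.hull.cyclic with hc | hc
  · exact ⟨P, Q, h, hc, .inl rfl⟩
  · exact ⟨_, _, h.reverse, by simpa using hc, .inr (by simp)⟩

lemma HullDetour.flipReach (h : HullDetour C ξ P Q) (h' : HullDetour C ξ P' Q')
    (hD : AdmitsInner D) (hξ : ξ ∉ C) : FlipReach D 4 (P ++ ξ :: Q) (P' ++ ξ :: Q') := by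
  obtain ⟨P₁, Q₁, h₁, hc₁, hs₁⟩ := h.exists_ccw
  obtain ⟨P₂, Q₂, h₂, hc₂, hs₂⟩ := h'.exists_ccw
  have key := h₁.flipReach_of_ccw h₂ hD hξ hc₁ hc₂
  rcases hs₁ with e₁ | e₁ <;> rcases hs₂ with e₂ | e₂ <;> rw [e₁, e₂] at key
  · exact key
  · simpa using key.reverse_right
  · simpa using key.reverse_left
  · simpa using key.reverse_left.reverse_right

/-- At most `k` flips within `D` turn the path described by `p` into a path along the boundary of
the convex hull of `C` with a detour to `ξ`. -/
def ReachesDetour (D : Set (PlanePath (insert ξ C))) (k : ℕ) (p : List Plane) : Prop :=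
  ∃ P Q, HullDetour C ξ P Q ∧ FlipReach D k p (P ++ ξ :: Q)

lemma FlipReach.reachesDetour {p q : List Plane} (h : FlipReach D k p q)
    (h' : ReachesDetour D m q) : ReachesDetour D (k + m) p := by
  obtain ⟨P, Q, hd, hq⟩ := h'
  exact ⟨P, Q, hd, h.trans hq⟩

lemma ReachesDetour.mono {p : List Plane} (h : ReachesDetour D k p) (hkm : k ≤ m) :
    ReachesDetour D m p := by
  obtain ⟨P, Q, hd, hp⟩ := h
  exact ⟨P, Q, hd, hp.mono hkm⟩

lemma ReachesDetour.join_comm (h : ReachesDetour D k (join ξ A B)) :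
    ReachesDetour D k (join ξ B A) := by
  obtain ⟨P, Q, hd, hp⟩ := h
  exact ⟨P, Q, hd, hp.join_comm_left⟩

lemma HullDetour.reachesDetour (h : HullDetour C ξ P Q) (hD : AdmitsInner D) (hξ : ξ ∉ C) :
    ReachesDetour D 0 (join ξ P.reverse Q) := by
  rw [join_reverse_left_eq]
  exact ⟨P, Q, h, (h.planeListIn_self hD hξ).refl⟩

lemma HullDetour.reachesDetour_reverse_right (h : HullDetour C ξ P Q) (hD : AdmitsInner D)
    (hξ : ξ ∉ C) (hp : PlaneListIn D (join ξ P.reverse Q.reverse)) :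
    ReachesDetour D (min (Q.length - 1) 1) (join ξ P.reverse Q.reverse) := by
  have hq : PlaneListIn D (join ξ P.reverse Q.reverse.reverse) := by
    rw [List.reverse_reverse, join_reverse_left_eq]
    exact h.planeListIn_self hD hξ
  have hr := hp.join_reverse_right hq
  rw [List.reverse_reverse, List.length_reverse] at hr
  exact hr.reachesDetour (h.reachesDetour hD hξ)

end Detours

section Arcs

variable {C : Set Plane} {ξ a b : Plane} {D : Set (PlanePath (insert ξ C))}
  {X X₁ X₂ Y Y₁ Y₂ R w w' : List Plane}

/-- The points `a` and `b` of `C` and the arc `X₂ ++ X₁` from `a` to `b` on the hull of `C` are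
visible from `ξ`. The lists `X₁`, `X₂` and `Y₁`, `Y₂` split the two arcs between `a` and `b` into
the parts that a plane path through `a`, `ξ`, `b` visits on the side of `b` and of `a`. -/
structure VisibleArc (C : Set Plane) (ξ a b : Plane) (X₁ X₂ Y₁ Y₂ : List Plane) : Prop where
  hull : IsHull C (a :: (X₂ ++ X₁) ++ b :: (Y₁ ++ Y₂))
  left_visible : SeesPast ξ C a
  right_visible : SeesPast ξ C b
  arc_visible : ∀ x ∈ X₂ ++ X₁, SeesPast ξ C x

lemma VisibleArc.symm (h : VisibleArc C ξ a b X₁ X₂ Y₁ Y₂) :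
    VisibleArc C ξ b a X₂.reverse X₁.reverse Y₂.reverse Y₁.reverse where
  hull := by
    have h' := IsHull.rotate (l₁ := a :: (X₂ ++ X₁) ++ [b]) (l₂ := Y₁ ++ Y₂) (by simpa using h.hull)
    simpa using h'.reverse
  left_visible := h.right_visible
  right_visible := h.left_visible
  arc_visible x hx := h.arc_visible x (by simpa [or_comm] using hx)

lemma VisibleArc.joinZigs (h : VisibleArc C ξ a b X₁ X₂ Y₁ Y₂) (hD : AdmitsInner D) (hξ : ξ ∉ C) :
    JoinZigs D ξ a b (X₂ ++ Y₂) (Y₁ ++ X₁) := by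
  intro u u' hu hu'
  have hhull := IsHull.rotate (l₁ := a :: (X₂ ++ X₁) ++ b :: Y₁) (by simpa using h.hull)
  refine hD.planeListIn (I := Y₂ ++ a :: X₂) (J := X₁ ++ b :: Y₁) hξ (by simpa using hhull)
    (pathOn_cons_iff.2 ⟨_, _, rfl, hu⟩) (pathOn_cons_iff.2 ⟨_, _, rfl, hu'⟩) (by simp) (by simp)
    (headVisible_cons.2 h.left_visible) (headVisible_cons.2 h.right_visible)

lemma VisibleArc.hullDetour (h : VisibleArc C ξ a b X [] Y₁ Y₂) :
    HullDetour C ξ (Y₂ ++ [a]) (X ++ b :: Y₁) where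
  hull := by simpa using h.hull.rotate (l₁ := [a]) (l₂ := X ++ b :: (Y₁ ++ Y₂))
  left_ne := by simp
  right_ne := by simp
  head_visible := by
    rw [List.append_assoc]
    exact (HeadVisible.of_forall h.arc_visible).append fun _ => headVisible_cons.2 h.right_visible
  last_visible := by simpa [headVisible_cons] using h.left_visible

lemma VisibleArc.reachesDetour_of_monotone (h : VisibleArc C ξ a b X [] Y₁ Y₂)
    (hD : AdmitsInner D) (hξ : ξ ∉ C) : ReachesDetour D (min X.length 1 + min Y₁.length 1)
      (join ξ (a :: Y₂.reverse) (b :: (Y₁ ++ X.reverse))) := by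
  have hdetour := h.hullDetour.reachesDetour hD hξ
  have hp₃ := h.hullDetour.planeListIn_self hD hξ
  rw [← join_reverse_left_eq] at hp₃
  simp only [List.reverse_append, List.reverse_singleton, List.singleton_append] at hdetour hp₃
  rcases eq_or_ne X [] with rfl | hX
  · simpa using hdetour.mono (Nat.zero_le _)
  have hp₁ := h.joinZigs hD hξ _ _ (zig_reverse _) ((zig_reverse X).prepend Y₁)
  have hp₂ : PlaneListIn D (join ξ (a :: Y₂.reverse) (X ++ (b :: Y₁).reverse)) := by
    refine h.hullDetour.planeListIn hD hξ (by simpa using pathOn_reverse (Y₂ ++ [a]))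
      ⟨[], _, rfl, by simpa using (zig_reverse (b :: Y₁)).prepend X⟩
      (headVisible_cons.2 h.left_visible) (.append (.of_forall h.arc_visible) (absurd · hX))
  have hrev : (b :: (Y₁ ++ X.reverse)).reverse = X ++ (b :: Y₁).reverse := by simp
  have h₁ := hp₁.join_reverse_right (hrev ▸ hp₂)
  rw [hrev] at h₁
  have h₂ := hp₂.join_reverse_suffix (by simpa using hp₃)
  rw [List.reverse_reverse] at h₂
  have := List.length_pos_of_ne_nil hX
  exact ((h₁.trans h₂).reachesDetour hdetour).mono (by simp; lia)

lemma VisibleArc.reachesDetour_of_head (h : VisibleArc C ξ a b X₁ X₂ Y₁ Y₂) (hD : AdmitsInner D)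
    (hξ : ξ ∉ C) (hw : Zig (X₂ ++ Y₂) w) (hw' : Zig (Y₁ ++ X₁) w')
    (hY : Y₁ = [] ∨ ZigHead (Y₁ ++ X₁) w') :
    ReachesDetour D ((X₂ ++ Y₂).length + (Y₁ ++ X₁).length + 1)
      (join ξ (a :: w) (b :: w')) := by
  have hz := h.joinZigs hD hξ
  have h₁ := hz.flipReach_left hw' fun p₀ hp₀ => (hw.flipReach hp₀).2
  have h₂ := hz.flipReach_right (zig_reverse _) fun p₀ hp₀ => hw'.flipReach_turn hp₀ hY
  have hsplit : VisibleArc C ξ a b (X₂ ++ X₁) [] Y₁ Y₂ :=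
    ⟨h.hull, h.left_visible, h.right_visible, h.arc_visible⟩
  have h₃ : FlipReach D (min X₂.length 1)
      (join ξ (a :: (X₂ ++ Y₂).reverse) (b :: (Y₁ ++ X₁.reverse)))
      (join ξ (a :: Y₂.reverse) (b :: (Y₁ ++ (X₂ ++ X₁).reverse))) := by
    have hp := hz _ _ (zig_reverse _) ((zig_reverse X₁).prepend Y₁)
    have hq := hsplit.joinZigs hD hξ _ _ (zig_reverse _) ((zig_reverse _).prepend Y₁)
    simpa using PlaneListIn.join_move (A := a :: Y₂.reverse) (M := X₂.reverse)
      (B := b :: (Y₁ ++ X₁.reverse)) (by simpa using hp) (by simpa using hq)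
  refine (((h₁.trans h₂).trans h₃).reachesDetour (hsplit.reachesDetour_of_monotone hD hξ)).mono ?_
  simp only [List.length_append]
  lia

lemma VisibleArc.reachesDetour_of_turn (h : VisibleArc C ξ a b X₁ X₂ Y []) (hD : AdmitsInner D)
    (hξ : ξ ∉ C) : ReachesDetour D (min X₂.length 1 + min Y.length 1 + min X₁.length 1)
      (join ξ (a :: X₂) (b :: (X₁.reverse ++ Y))) := by
  have hX₂ : HeadVisible C ξ (a :: X₂).reverse := .of_forall fun x hx => by
    rcases List.mem_cons.1 (List.mem_reverse.1 hx) with rfl | hx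
    exacts [h.left_visible, h.arc_visible x (List.mem_append_left _ hx)]
  have hb {l : List Plane} : HeadVisible C ξ (b :: l) := headVisible_cons.2 h.right_visible
  have hhull : IsHull C (a :: X₂ ++ (X₁ ++ b :: Y)) := by simpa using h.hull
  have hhull' : IsHull C ((X₁ ++ [b]) ++ (Y ++ a :: X₂)) := by
    simpa using hhull.rotate
  have hdetour : HullDetour C ξ (Y ++ a :: X₂) (X₁ ++ [b]) :=
    { hull := hhull'
      left_ne := by simp
      right_ne := by simp
      head_visible := by
        rw [List.append_assoc]
        exact (HeadVisible.of_forall fun x hx => h.arc_visible x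
          (List.mem_append_right _ hx)).append fun _ => hb
      last_visible := by
        rw [← List.append_assoc, List.reverse_append]
        exact hX₂.append (by simp) }
  have hp₁ : PlaneListIn D (join ξ (a :: X₂) (b :: (X₁.reverse ++ Y))) := by
    simpa using h.joinZigs hD hξ _ _ (zig_self _) ((zig_self Y).append X₁)
  have hp₂ : PlaneListIn D (join ξ (a :: X₂).reverse (b :: (X₁.reverse ++ Y))) :=
    hD.planeListIn hξ hhull (pathOn_reverse _)
      (pathOn_cons_iff.2 ⟨X₁, Y, rfl, (zig_self Y).append X₁⟩) (by simp) (by simp) hX₂ hb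
  have hp₃ : PlaneListIn D (join ξ (Y ++ a :: X₂).reverse (X₁ ++ [b]).reverse) :=
    hdetour.planeListIn hD hξ (pathOn_reverse _) (pathOn_reverse _) hdetour.left_visible
      (by simpa using hb)
  have h₁ := hp₁.join_reverse_left hp₂
  have h₂ := PlaneListIn.join_move_reverse (A := (a :: X₂).reverse) (B := b :: X₁.reverse) hp₂
    (by simpa using hp₃)
  have h₃ := hdetour.reachesDetour_reverse_right hD hξ hp₃
  rw [List.reverse_append, List.reverse_concat'] at h₃
  exact ((h₁.trans h₂).reachesDetour h₃).mono (by simp)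

lemma VisibleArc.reachesDetour_of_ends (h : VisibleArc C ξ a b X₁ X₂ Y₁ Y₂) (hD : AdmitsInner D)
    (hξ : ξ ∉ C) (hw : ZigHead (X₂ ++ Y₂) w) (hw' : ZigLast (Y₁ ++ X₁) w') :
    ReachesDetour D ((X₂ ++ Y₂).length + (Y₁ ++ X₁).length + 1)
      (join ξ (a :: w) (b :: w')) := by
  have hz := h.joinZigs hD hξ
  have hhead : ZigHead (X₁.reverse ++ Y₁.reverse) w' := by simpa using hw'.reverse_left
  have h₁ := hz.flipReach_left hw'.zig fun p₀ hp₀ => hw.flipReach hp₀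
  have h₂ := hz.flipReach_right (zig_self _) fun p₀ hp₀ =>
    hhead.zig.flipReach_turn (by simpa using hp₀.reverse) (.inr hhead)
  rw [List.reverse_reverse] at h₂
  have hsplit : VisibleArc C ξ a b X₁ X₂ (Y₁ ++ Y₂) [] :=
    ⟨by simpa using h.hull, h.left_visible, h.right_visible, h.arc_visible⟩
  have h₃ : FlipReach D (min Y₂.length 1) (join ξ (a :: (X₂ ++ Y₂)) (b :: (X₁.reverse ++ Y₁)))
      (join ξ (a :: X₂) (b :: (X₁.reverse ++ (Y₁ ++ Y₂)))) := by
    have hp := hz _ _ (zig_self _) ((zig_self Y₁).append X₁)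
    have hq := hsplit.joinZigs hD hξ _ _ (zig_self _) ((zig_self _).append X₁)
    simpa using PlaneListIn.join_move (A := a :: X₂) (M := Y₂) (B := b :: (X₁.reverse ++ Y₁))
      hp (by simpa using hq)
  have hpos := hw.length_pos
  have hpos' := hhead.length_pos
  refine (((h₁.trans h₂).trans h₃).reachesDetour (hsplit.reachesDetour_of_turn hD hξ)).mono ?_
  simp only [List.length_append, List.length_reverse] at hpos hpos' ⊢
  lia

lemma VisibleArc.reachesDetour (h : VisibleArc C ξ a b X₁ X₂ Y₁ Y₂) (hD : AdmitsInner D)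
    (hξ : ξ ∉ C) (hw : Zig (X₂ ++ Y₂) w) (hw' : Zig (Y₁ ++ X₁) w') :
    ReachesDetour D ((X₂ ++ Y₂).length + (Y₁ ++ X₁).length + 1)
      (join ξ (a :: w) (b :: w')) := by
  rcases hw'.eq_nil_or_zigHead_or_zigLast with hnil | hhead' | hlast'
  · exact h.reachesDetour_of_head hD hξ hw hw' (.inl (List.append_eq_nil_iff.1 hnil.1).1)
  · exact h.reachesDetour_of_head hD hξ hw hw' (.inr hhead')
  have hsymm (hY : Y₂.reverse = [] ∨ ZigHead (Y₂.reverse ++ X₂.reverse) w) :=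
    (h.symm.reachesDetour_of_head hD hξ (by simpa using hw'.reverse_left)
      (by simpa using hw.reverse_left) hY).join_comm.mono
      (m := (X₂ ++ Y₂).length + (Y₁ ++ X₁).length + 1) (by simp; lia)
  rcases hw.eq_nil_or_zigHead_or_zigLast with hnil | hhead | hlast
  · exact hsymm (.inl (by simp [(List.append_eq_nil_iff.1 hnil.1).2]))
  · exact h.reachesDetour_of_ends hD hξ hhead hlast'
  · exact hsymm (.inr (by simpa using hlast.reverse_left))

lemma reachesDetour_of_straight (hD : AdmitsInner D) (hξ : ξ ∉ C)
    (hhull : IsHull C ((a :: R) ++ (X ++ b :: Y))) (hY : Y ≠ [] → SeesPast ξ C b)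
    (hlast : HeadVisible C ξ (a :: R).reverse) (hhead : HeadVisible C ξ (X ++ b :: Y))
    (hp : PlaneListIn D (join ξ (a :: R).reverse (b :: (X.reverse ++ Y.reverse)))) :
    ReachesDetour D (min X.length 1 + min Y.length 1)
      (join ξ (a :: R).reverse (b :: (X.reverse ++ Y.reverse))) := by
  have hdetour : HullDetour C ξ (Y ++ a :: R) (X ++ [b]) :=
    { hull := by simpa using hhull.rotate
      left_ne := by simp
      right_ne := by simp
      head_visible := by
        have : HeadVisible C ξ (X ++ [b]) := by cases X <;> simpa [HeadVisible] using hhead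
        exact this.append (by simp)
      last_visible := by
        rw [← List.append_assoc, List.reverse_append]
        exact hlast.append (by simp) }
  have hq : PlaneListIn D (join ξ (Y ++ a :: R).reverse (X ++ [b]).reverse) := by
    rcases eq_or_ne Y [] with rfl | hne
    · simpa using hp
    · exact hdetour.planeListIn hD hξ (pathOn_reverse _) (pathOn_reverse _) hdetour.left_visible
        (by simpa using headVisible_cons.2 (hY hne))
  have h₁ := (PlaneListIn.join_move (A := (a :: R).reverse) (M := Y.reverse) (B := b :: X.reverse)
    (by simpa using hq) (by simpa using hp)).symm
  have h₂ := hdetour.reachesDetour_reverse_right hD hξ hq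
  rw [List.reverse_append, List.reverse_concat'] at h₂
  exact (h₁.reachesDetour h₂).mono (by simp; lia)

lemma reachesDetour_of_hidden (hD : AdmitsInner D) (hξ : ξ ∉ C)
    (hhull : IsHull C ((a :: R) ++ (X ++ b :: Y))) (hR : R ≠ [])
    (ha : SeesPast ξ {x | x ∈ a :: R} a ∧ SeesPast ξ {x | x ∈ X ++ b :: Y} a)
    (hb : SeesPast ξ {x | x ∈ a :: R} b ∧ SeesPast ξ {x | x ∈ X ++ b :: Y} b)
    (hY : Y ≠ [] → SeesPast ξ C b) (hlast : HeadVisible C ξ R.reverse)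
    (hhead : HeadVisible C ξ (X ++ b :: Y)) (hw : Zig R w) (hw' : Zig (Y ++ X) w') :
    ReachesDetour D (R.length + X.length + Y.length + 1) (join ξ (a :: w) (b :: w')) := by
  have hright {u : List Plane} (hu : Zig (Y ++ X) u) : PathOn (X ++ b :: Y) (b :: u) :=
    pathOn_cons_iff.2 ⟨X, Y, rfl, hu⟩
  have hz : JoinZigs D ξ a b R (Y ++ X) := fun u u' hu hu' =>
    hD _ _ (by simp) (by simp) (planeList_join hξ hhull
      (pathOn_cons_iff.2 ⟨[], R, rfl, by simpa using hu⟩) (hright hu') fun c hc => by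
        rcases hc with hc | hc <;> obtain rfl : _ = c := by simpa using hc
        exacts [ha, hb])
  have hlast' : HeadVisible C ξ (a :: R).reverse := by
    rw [List.reverse_cons]
    exact hlast.append (absurd · (by simpa using hR))
  have hq : PlaneListIn D (join ξ (a :: R).reverse (b :: (Y ++ X).reverse)) :=
    hD _ _ (by simp) (by simp) (planeList_join hξ hhull (pathOn_reverse _)
      (hright (zig_reverse _)) fun c hc => by
        rcases hc with hc | hc
        · have hvis := hlast' c hc
          exact ⟨hvis.mono fun x hx => (hhull.mem_iff x).1 (List.mem_append_left _ hx),
            hvis.mono fun x hx => (hhull.mem_iff x).1 (List.mem_append_right _ hx)⟩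
        · obtain rfl : b = c := by simpa using hc
          exact hb)
  have h₁ := hz.flipReach_left hw' fun p₀ hp₀ => (hw.flipReach hp₀).1
  have h₂ := hz.flipReach_right (zig_self R) fun p₀ hp₀ => (hw'.flipReach hp₀).2
  have h₃ := (hz _ _ (zig_self _) (zig_reverse _)).join_reverse_left hq
  rw [List.reverse_append] at hq h₂ h₃
  have h₄ := reachesDetour_of_straight hD hξ hhull hY hlast' hhead hq
  have := List.length_pos_of_ne_nil hR
  exact (((h₁.trans h₂).trans h₃).reachesDetour h₄).mono (by simp; lia)

end Arcs

section Separation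

variable {C : Set Plane} {ξ a b : Plane} {A B G H I J R L X Y w w' : List Plane}

lemma CyclicOrder.exists_meets {u v : Plane} {b b' : Plane} (hc : CyclicOrder (u :: G ++ v :: H))
    (hn : (u :: G ++ v :: H).Nodup) (hA : A ⊆ u :: G ++ v :: H) (hB : B ⊆ u :: G ++ v :: H)
    (hAB : A.Disjoint B) (hu : u ∈ A) (hv : v ∈ A) (hb : b ∈ B) (hbG : b ∈ G) (hb' : b' ∈ B)
    (hbH : b' ∈ H) : ∃ s t c d, Linked s t A ∧ Linked c d B ∧ Meets s t c d := by
  obtain ⟨c, d, hcd, hcG, hdH⟩ := exists_linked_across hn hB (hAB hu) (hAB hv) hb hbG hb' hbH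
  obtain ⟨G₁, G₂, rfl⟩ := List.append_of_mem hcG
  obtain ⟨H₁, H₂, rfl⟩ := List.append_of_mem hdH
  have hsplit : u :: (G₁ ++ c :: G₂) ++ v :: (H₁ ++ d :: H₂) =
      (u :: G₁) ++ (c :: (G₂ ++ v :: H₁) ++ d :: H₂) := by simp
  have hrotate : (c :: (G₂ ++ v :: H₁) ++ d :: H₂) ++ (u :: G₁) =
      c :: (G₂ ++ v :: H₁) ++ d :: (H₂ ++ u :: G₁) := by simp
  rw [hsplit] at hc hn hA
  have hc' := hc.rotate
  have hperm := List.perm_append_comm (l₁ := u :: G₁) (l₂ := c :: (G₂ ++ v :: H₁) ++ d :: H₂)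
  rw [hrotate] at hc' hperm
  obtain ⟨s, t, hst, hs, ht⟩ := exists_linked_across (hperm.nodup_iff.1 hn)
    (List.Subset.trans hA hperm.subset) (fun h => hAB h hcd.mem.1) (fun h => hAB h hcd.mem.2)
    hv (by simp) hu (by simp)
  have hsub := ((List.singleton_sublist.2 hs).cons_cons c).append
    ((List.singleton_sublist.2 ht).cons_cons d)
  exact ⟨s, t, c, d, hst, hcd, (hc'.sublist hsub).sides_diagonals.2.2.symm⟩

lemma PlaneList.join_comm {S : Set Plane} (hp : PlaneList S (join ξ A B)) :
    PlaneList S (join ξ B A) := by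
  rw [← join_reverse]
  exact hp.reverse

lemma PlaneList.nodup_append {S : Set Plane} (hp : PlaneList S (join ξ A B)) : (A ++ B).Nodup :=
  ((join_perm ξ A B).nodup_iff.1 hp.nodup).of_cons

lemma PlaneList.mem_append_iff (hξ : ξ ∉ C) (hp : PlaneList (insert ξ C) (join ξ A B))
    {x : Plane} : x ∈ A ++ B ↔ x ∈ C := by
  have hn := (List.nodup_cons.1 ((join_perm ξ A B).nodup_iff.1 hp.nodup)).1
  have hx : x = ξ ∨ x ∈ A ++ B ↔ x = ξ ∨ x ∈ C := by
    rw [← List.mem_cons, ← (join_perm ξ A B).mem_iff, hp.mem_iff, Set.mem_insert_iff]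
  rcases eq_or_ne x ξ with rfl | hne
  · exact iff_of_false hn hξ
  · simpa [hne] using hx

lemma PlaneList.append_perm (hξ : ξ ∉ C) (hp : PlaneList (insert ξ C) (join ξ A B))
    {l : List Plane} (hl : IsHull C l) : (A ++ B).Perm l :=
  (List.perm_ext_iff_of_nodup hp.nodup_append hl.nodup).2 fun x => by
    rw [hp.mem_append_iff hξ, hl.mem_iff]

lemma linked_join_left {s t : Plane} (h : Linked s t A) : Linked s t (join ξ A B) :=
  linked_append.2 (.inl (linked_reverse.2 h))

lemma linked_join_right {s t : Plane} (h : Linked s t B) : Linked s t (join ξ A B) := by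
  rw [← linked_reverse, join_reverse]
  exact linked_join_left h

lemma PlaneList.not_meets {S : Set Plane} (hp : PlaneList S (join ξ A B)) {s t c d : Plane}
    (hst : Linked s t A) (hcd : Linked c d B) : ¬ Meets s t c d := by
  have hdisj := List.disjoint_of_nodup_append hp.nodup_append
  exact hp.nonCrossing.not_meets (linked_join_left hst) (linked_join_right hcd)
    (fun e => hdisj hst.mem.1 (e ▸ hcd.mem.1)) (fun e => hdisj hst.mem.1 (e ▸ hcd.mem.2))
    (fun e => hdisj hst.mem.2 (e ▸ hcd.mem.1)) (fun e => hdisj hst.mem.2 (e ▸ hcd.mem.2))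

lemma PlaneList.zig_left (hp : PlaneList (insert ξ C) (join ξ (a :: w) B))
    (hl : IsHull C ((X ++ a :: Y) ++ J)) (hw : w.Perm (Y ++ X)) : Zig (Y ++ X) w := by
  have hc : CyclicOrder (a :: Y ++ X) := (hl.cyclic.sublist (List.sublist_append_left _ _)).rotate
  have hn : (a :: Y ++ X).Nodup := List.perm_append_comm.nodup_iff.1 hl.nodup.of_append_left
  exact NonCrossing.zig (fun s t c d hst hcd hsc hsd htc htd =>
    hp.nonCrossing.not_meets (linked_join_left (.inl hst)) (linked_join_left (.inl hcd))
      hsc hsd htc htd) hw hc hn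

lemma PlaneList.exists_arcs (hξ : ξ ∉ C) (hp : PlaneList (insert ξ C) (join ξ (a :: w) B))
    {l : List Plane} (hl : IsHull C (a :: l)) :
    ∃ P M Q, l = P ++ (M ++ Q) ∧ w.Perm (P ++ Q) ∧ B.Perm M := by
  have hperm := hp.append_perm hξ hl
  have hA : a :: w ⊆ a :: l := fun x hx => hperm.subset (List.mem_append_left _ hx)
  have hB : B ⊆ a :: l := fun x hx => hperm.subset (List.mem_append_right _ hx)
  have hdisj := List.disjoint_of_nodup_append hp.nodup_append
  obtain ⟨P, M, Q, rfl, hP, hM, hQ⟩ := exists_interval (· ∈ B) l fun x y z hs hx hz => by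
    by_contra hy
    obtain ⟨G, H, rfl, hxG, hzH⟩ := exists_append_of_sublist hs
    have hyA : y ∈ a :: w := (List.mem_append.1 (hperm.mem_iff.2 (by simp))).resolve_right hy
    obtain ⟨s, t, c, d, hst, hcd, hm⟩ := CyclicOrder.exists_meets (u := a) (v := y)
      hl.cyclic hl.nodup hA hB hdisj List.mem_cons_self hyA hx hxG hz hzH
    exact hp.not_meets hst hcd hm
  have hperm' : (w ++ B).Perm (P ++ Q ++ M) := by
    refine hperm.cons_inv.trans ?_
    rw [List.append_assoc]
    exact List.perm_append_comm.append_left P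
  refine ⟨P, M, Q, rfl, perm_and_perm_of_subset hperm' hp.nodup_append.of_cons
    (fun x hx => ?_) fun x hx => ?_⟩
  · have hxM : x ∉ M := fun h => hdisj (List.mem_cons_of_mem _ hx) (hM x h)
    simpa [hxM] using hperm'.subset (List.mem_append_left _ hx)
  · have hxP : x ∉ P := fun h => hP x h hx
    have hxQ : x ∉ Q := fun h => hQ x h hx
    simpa [hxP, hxQ] using hperm'.subset (List.mem_append_right _ hx)

variable {D : Set (PlanePath (insert ξ C))}

lemma OuterPoint.exists_hull_cons (h : OuterPoint C ξ) (ha : a ∈ C) :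
    ∃ l, IsHull C (a :: l) := by
  obtain ⟨l, hl, -⟩ := h.exists_hull ⟨a, ha⟩
  obtain ⟨s, t, rfl⟩ := List.append_of_mem ((hl.mem_iff a).2 ha)
  exact ⟨t ++ s, hl.rotate⟩

lemma OuterPoint.reachesDetour_of_seesPast (h : OuterPoint C ξ) (hD : AdmitsInner D)
    (hp : PlaneList (insert ξ C) (join ξ (a :: w) (b :: w'))) (ha : SeesPast ξ C a)
    (hb : SeesPast ξ C b) :
    ReachesDetour D (w.length + w'.length + 1) (join ξ (a :: w) (b :: w')) := by
  have hab : a ≠ b := fun e =>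
    List.disjoint_of_nodup_append hp.nodup_append List.mem_cons_self (e ▸ List.mem_cons_self)
  obtain ⟨X, Y, hXY, hX⟩ := h.exists_visible_arc ((hp.mem_append_iff h.notMem).1 (by simp))
    ((hp.mem_append_iff h.notMem).1 (by simp)) hab ha hb
  obtain ⟨P, M, Q, he, hw, hB⟩ := hp.exists_arcs h.notMem hXY
  obtain ⟨M₁, M₂, rfl⟩ := List.append_of_mem (hB.subset List.mem_cons_self)
  have he' : X ++ b :: Y = (P ++ M₁) ++ b :: (M₂ ++ Q) := by simpa using he
  have hn := hXY.nodup.of_cons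
  obtain ⟨rfl, -, rfl⟩ := (List.append_cons_inj_of_notMem
    (fun h => List.disjoint_of_nodup_append hn h List.mem_cons_self)
    (fun h => (hn.sublist (List.sublist_append_right _ _)).notMem h)).1 he'
  have hw' : w'.Perm (M₂ ++ M₁) :=
    (hB.trans List.perm_middle).cons_inv.trans List.perm_append_comm
  have hrot : IsHull C ((Q ++ a :: P) ++ (M₁ ++ b :: M₂)) := by
    have := IsHull.rotate (l₁ := a :: (P ++ M₁) ++ b :: M₂) (l₂ := Q) (by simpa using hXY)
    simpa using this
  have harc : VisibleArc C ξ a b M₁ P M₂ Q := ⟨by simpa using hXY, ha, hb, hX⟩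
  rw [hw.length_eq, hw'.length_eq]
  exact harc.reachesDetour hD h.notMem (hp.zig_left hrot hw) (hp.join_comm.zig_left hrot.rotate hw')

end Separation

section Sides

variable {C : Set Plane} {ξ a b : Plane} {B R L X Y w w' : List Plane}

lemma SeesPast.of_subset_insert {T T' : Set Plane} (h : SeesPast ξ T a) (hT : T' ⊆ insert a T) :
    SeesPast ξ T' a :=
  fun x hx y hy hxy hxa hya => h x ((hT hx).resolve_left hxa) y ((hT hy).resolve_left hya) hxy
    hxa hya

lemma IsSplit.subset_or_subset {T : List Plane} (hs : IsSplit C ξ a R L) (hT : T ⊆ R ++ L)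
    (hm : ∀ c d, Linked c d T → ¬ Meets ξ a c d) : T ⊆ R ∨ T ⊆ L := by
  by_contra! hne
  obtain ⟨⟨x, hx, hxR⟩, y, hy, hyL⟩ : (∃ x ∈ T, x ∉ R) ∧ ∃ y ∈ T, y ∉ L := by
    simpa [List.subset_def] using hne
  have hyR : y ∈ R := (List.mem_append.1 (hT hy)).resolve_right hyL
  obtain ⟨c, d, hcd, hc, hd⟩ := exists_linked_of_mem (· ∈ R) hy hx hyR hxR
  have hdL : d ∈ L := (List.mem_append.1 (hT hcd.mem.2)).resolve_left hd
  exact hm c d hcd (hs.meets c hc d hdL)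

lemma PlaneList.not_meets_head {S : Set Plane} (hp : PlaneList S (join ξ (a :: w) B))
    {c d : Plane} (hcd : Linked c d w ∨ Linked c d B) : ¬ Meets ξ a c d := by
  have hn : (ξ :: a :: (w ++ B)).Nodup := (join_perm ξ (a :: w) B).nodup_iff.1 hp.nodup
  have hmem : c ∈ w ++ B ∧ d ∈ w ++ B := by
    rcases hcd with h | h <;> simp [h.mem]
  have hlink : Linked c d (join ξ (a :: w) B) :=
    hcd.elim (fun h => linked_join_left ((linked_append (l₁ := [a])).2 (.inr (.inl h))))
      linked_join_right
  have hξ {x : Plane} (hx : x ∈ w ++ B) : ξ ≠ x := by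
    rintro rfl
    exact hn.notMem (List.mem_cons_of_mem _ hx)
  have ha {x : Plane} (hx : x ∈ w ++ B) : a ≠ x := by
    rintro rfl
    exact hn.of_cons.notMem hx
  exact hp.nonCrossing.not_meets ((linked_join_iff hp.nodup).2 (.inl rfl)) hlink (hξ hmem.1)
    (hξ hmem.2) (ha hmem.1) (ha hmem.2)

lemma IsSplit.perm_or_perm (hξ : ξ ∉ C) (hs : IsSplit C ξ a R L) (hl : IsHull C (a :: (R ++ L)))
    (hp : PlaneList (insert ξ C) (join ξ (a :: w) B)) :
    (w.Perm R ∧ B.Perm L) ∨ (w.Perm L ∧ B.Perm R) := by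
  have hperm : (w ++ B).Perm (R ++ L) := (hp.append_perm hξ hl).cons_inv
  have hn : (w ++ B).Nodup := hp.nodup_append.of_cons
  have hdisj : R.Disjoint L := List.disjoint_of_nodup_append (hperm.nodup_iff.1 hn)
  have hw := hs.subset_or_subset
    (List.Subset.trans (List.subset_append_left w B) hperm.subset)
    fun c d hcd => hp.not_meets_head (.inl hcd)
  have hB := hs.subset_or_subset
    (List.Subset.trans (List.subset_append_right w B) hperm.subset)
    fun c d hcd => hp.not_meets_head (.inr hcd)
  rcases hw with hw | hw <;> rcases hB with hB | hB
  · obtain ⟨y, hy⟩ := List.exists_mem_of_ne_nil _ hs.right_ne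
    have hyR := List.append_subset.2 ⟨hw, hB⟩ (hperm.symm.subset (List.mem_append_right R hy))
    exact absurd hy (hdisj hyR)
  · exact .inl (perm_and_perm_of_subset hperm hn hw hB)
  · exact .inr (perm_and_perm_of_subset (hperm.trans List.perm_append_comm) hn hw hB)
  · obtain ⟨x, hx⟩ := List.exists_mem_of_ne_nil _ hs.left_ne
    have hxL := List.append_subset.2 ⟨hw, hB⟩ (hperm.symm.subset (List.mem_append_left L hx))
    exact absurd hxL (hdisj hx)

lemma OuterPoint.exists_sides (h : OuterPoint C ξ)
    (hp : PlaneList (insert ξ C) (join ξ (a :: w) B)) (ha : ¬ SeesPast ξ C a) :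
    ∃ R L, IsHull C (a :: (R ++ L)) ∧ IsSplit C ξ a R L ∧ w.Perm R ∧ B.Perm L := by
  obtain ⟨l, hl⟩ := h.exists_hull_cons ((hp.mem_append_iff h.notMem (x := a)).1 (by simp))
  obtain ⟨R, L, rfl, hs⟩ := h.exists_isSplit hl ha
  rcases hs.perm_or_perm h.notMem hl hp with ⟨hw, hB⟩ | ⟨hw, hB⟩
  · exact ⟨R, L, hl, hs, hw, hB⟩
  · refine ⟨L.reverse, R.reverse, ?_, hs.reverse, hw.trans (List.reverse_perm L).symm,
      hB.trans (List.reverse_perm R).symm⟩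
    have hrev := hl.reverse
    rw [List.reverse_cons, List.reverse_append] at hrev
    exact hrev.rotate

lemma OuterPoint.sees_of_hidden_of_hidden (h : OuterPoint C ξ)
    (hl : IsHull C ((a :: R) ++ (X ++ b :: Y))) (hw : w.Perm R) (hw' : w'.Perm (Y ++ X))
    (hp : PlaneList (insert ξ C) (join ξ (a :: w) (b :: w'))) (ha : ¬ SeesPast ξ C a)
    (hb : ¬ SeesPast ξ C b) :
    Y = [] ∧ SeesPast ξ {x | x ∈ a :: R} b ∧ SeesPast ξ {x | x ∈ X ++ b :: Y} b := by
  have hl' : IsHull C (b :: (Y ++ (a :: R ++ X))) :=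
    IsHull.rotate (l₁ := a :: R ++ X) (l₂ := b :: Y) (by simpa using hl)
  obtain ⟨R', L', he, hs⟩ := h.exists_isSplit hl' hb
  rw [he] at hl'
  have hdisj : R'.Disjoint L' := List.disjoint_of_nodup_append hl'.nodup.of_cons
  rcases hs.perm_or_perm h.notMem hl' hp.join_comm with ⟨hR', hL'⟩ | ⟨hL', hR'⟩
  · have hX : X = [] := by
      rcases List.eq_nil_or_concat' X with rfl | ⟨X, x, rfl⟩
      · rfl
      obtain ⟨L₀, z, rfl⟩ := (List.eq_nil_or_concat' L').resolve_left hs.right_ne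
      have he' : (Y ++ (a :: R ++ X)) ++ [x] = (R' ++ L₀) ++ [z] := by simpa using he
      obtain ⟨-, rfl⟩ := List.append_singleton_inj.1 he'
      exact absurd (by simp) (hdisj (hR'.subset (hw'.symm.subset (by simp : x ∈ Y ++ (X ++ [x])))))
    subst hX
    rw [List.append_nil] at he
    obtain ⟨-, rfl⟩ := List.append_inj' he ((hw.cons a).symm.trans hL').length_eq
    exact absurd (headVisible_cons.1 hs.head_visible) ha
  · have haR : (a :: R).Perm R' := (hw.symm.cons a).trans hR'
    have hYX : (Y ++ X).Perm L' := hw'.symm.trans hL'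
    refine ⟨?_, hs.sees_left.mono haR.subset, hs.sees_right.of_subset_insert ?_⟩
    · rcases Y with _ | ⟨y, Y⟩
      · rfl
      obtain ⟨z, R₀, rfl⟩ := List.exists_cons_of_ne_nil hs.left_ne
      obtain rfl : y = z := (List.cons_eq_cons.1 he).1
      exact absurd (hYX.subset (by simp)) (hdisj List.mem_cons_self)
    · exact fun x hx => (List.mem_cons.1 (List.perm_middle.subset hx)).imp_right fun hx =>
        hYX.subset (List.perm_append_comm.subset hx)

variable {D : Set (PlanePath (insert ξ C))}

lemma OuterPoint.reachesDetour_of_not_seesPast (h : OuterPoint C ξ) (hD : AdmitsInner D)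
    (hp : PlaneList (insert ξ C) (join ξ (a :: w) (b :: w'))) (ha : ¬ SeesPast ξ C a) :
    ReachesDetour D (w.length + w'.length + 1) (join ξ (a :: w) (b :: w')) := by
  obtain ⟨R, L, hl, hs, hw, hB⟩ := h.exists_sides hp ha
  obtain ⟨X, Y, rfl⟩ := List.append_of_mem (hB.subset List.mem_cons_self)
  have hw' : w'.Perm (Y ++ X) :=
    (hB.trans List.perm_middle).cons_inv.trans List.perm_append_comm
  have hl' : IsHull C ((a :: R) ++ (X ++ b :: Y)) := hl
  have hb : SeesPast ξ {x | x ∈ a :: R} b ∧ SeesPast ξ {x | x ∈ X ++ b :: Y} b ∧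
      (Y ≠ [] → SeesPast ξ C b) := by
    by_cases hb : SeesPast ξ C b
    · exact ⟨hb.mono fun x hx => (hl'.mem_iff x).1 (List.mem_append_left _ hx),
        hb.mono fun x hx => (hl'.mem_iff x).1 (List.mem_append_right _ hx), fun _ => hb⟩
    · obtain ⟨hY, hbR, hbL⟩ := h.sees_of_hidden_of_hidden hl' hw hw' hp ha hb
      exact ⟨hbR, hbL, absurd hY⟩
  have hz : Zig R w := by
    simpa using hp.zig_left (X := []) (Y := R) (by simpa using hl') (by simpa using hw)
  have key := reachesDetour_of_hidden hD h.notMem hl' hs.left_ne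
    ⟨hs.sees_left.of_subset_insert fun x hx => List.mem_cons.1 hx, hs.sees_right⟩ ⟨hb.1, hb.2.1⟩
    hb.2.2 hs.last_visible hs.head_visible
    hz (hp.join_comm.zig_left hl'.rotate hw')
  refine key.mono ?_
  rw [hw.length_eq, hw'.length_eq, List.length_append]
  lia

lemma OuterPoint.reachesDetour (h : OuterPoint C ξ) (hD : AdmitsInner D)
    (hp : PlaneList (insert ξ C) (join ξ (a :: w) (b :: w'))) :
    ReachesDetour D (w.length + w'.length + 1) (join ξ (a :: w) (b :: w')) := by
  by_cases ha : SeesPast ξ C a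
  · by_cases hb : SeesPast ξ C b
    · exact h.reachesDetour_of_seesPast hD hp ha hb
    · rw [add_comm w.length]
      exact (h.reachesDetour_of_not_seesPast hD hp.join_comm hb).join_comm
  · exact h.reachesDetour_of_not_seesPast hD hp ha

end Sides

section Pivot

variable {S : Set Plane} {D : Set (PlanePath S)} {ξ c c' x : Plane} {k l : ℕ}
  {p₀ p p' v w w' T X Y : List Plane}

lemma Zig.flipReach_pivot (hw : Zig (X ++ c :: Y) w) (h : AllZigs D p₀ (X ++ c :: Y))
    (hXY : X = [] ∨ Y = [] ∨ ZigHead (X ++ c :: Y) w) :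
    FlipReach D (X.length + Y.length) (p₀ ++ w) (p₀ ++ (X ++ (c :: Y).reverse)) := by
  have hlen : (X ++ c :: Y).length - 1 = X.length + Y.length := by simp
  rcases hXY with hX | rfl | hhead
  · exact hlen ▸ hw.flipReach_turn h (.inl hX)
  · exact hlen ▸ (hw.flipReach h).1
  · exact hlen ▸ hw.flipReach_turn h (.inr hhead)

lemma Zig.flipReach_pivot_succ (hw : Zig (X ++ c :: Y) w) (h : AllZigs D p₀ (X ++ c :: Y)) :
    FlipReach D (X.length + Y.length + 1) (p₀ ++ w) (p₀ ++ (X ++ (c :: Y).reverse)) := by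
  have hstraight : PlaneListIn D ((p₀ ++ X) ++ c :: Y) := by simpa using h _ (zig_self _)
  have hpivot : PlaneListIn D ((p₀ ++ X) ++ (c :: Y).reverse) := by
    simpa using h _ ((zig_reverse (c :: Y)).prepend X)
  have hturn := hstraight.reverse_suffix hpivot
  rw [List.append_assoc, List.append_assoc] at hturn
  refine ((hw.flipReach h).1.trans hturn).mono ?_
  simp only [List.length_append, List.length_cons]
  lia

lemma PlaneListIn.flipReach_of_reverse (hT : PlaneListIn D (ξ :: T))
    (hT' : PlaneListIn D (ξ :: T.reverse)) (h : FlipReach D k p (ξ :: T))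
    (h' : FlipReach D l p' (ξ :: T.reverse)) : FlipReach D (k + l + 1) p p' :=
  ((h.trans (reverse_suffix (p₁ := [ξ]) hT hT')).trans h'.symm).mono (by lia)

lemma AllZigs.flipReach_of_pivots (h : AllZigs D [ξ, c] (X ++ c' :: Y))
    (h' : AllZigs D [ξ, c'] (Y ++ c :: X))
    (hw : FlipReach D k p ([ξ, c] ++ (X ++ (c' :: Y).reverse)))
    (hw' : FlipReach D l p' ([ξ, c'] ++ (Y ++ (c :: X).reverse))) :
    FlipReach D (k + l + 1) p p' := by
  have hT := h _ ((zig_reverse (c' :: Y)).prepend X)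
  have hT' := h' _ ((zig_reverse (c :: X)).prepend Y)
  have hrev : [ξ, c'] ++ (Y ++ (c :: X).reverse) =
      ξ :: (c :: (X ++ (c' :: Y).reverse)).reverse := by simp
  rw [hrev] at hT' hw'
  exact hT.flipReach_of_reverse hT' hw hw'

lemma AllZigs.flipReach_zigzag_left (h : AllZigs D [ξ, c] (x :: X ++ c' :: Y))
    (hv : ZigLast (X ++ c' :: Y) v) (hX : X ≠ []) :
    FlipReach D (X.length + Y.length) ([ξ, c] ++ x :: v)
      ([ξ, c, x] ++ (Y.reverse ++ (X ++ [c']))) := by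
  have htail : AllZigs D [ξ, c, x] (X ++ c' :: Y) := h.tail
  have hstraight := hv.reverse_left.flipReach htail.reverse
  have hself := htail _ (zig_reverse _)
  have hturned := htail (Y.reverse ++ (X ++ [c'])) (by simpa using (zig_self (X ++ [c'])).append Y)
  have hflip := PlaneListIn.reverse_suffix (p₁ := [ξ, c, x] ++ Y.reverse)
    (p₂ := (X ++ [c']).reverse) (by simpa using hself) (by simpa using hturned)
  simp only [List.reverse_reverse] at hflip
  have := List.length_pos_iff.2 hX
  refine (hstraight.trans (by simpa using hflip)).mono ?_
  simp only [List.length_reverse, List.length_append, List.length_cons]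
  lia

lemma AllZigs.flipReach_zigzag_right (h : AllZigs D [ξ, c'] (Y ++ c :: x :: X))
    (hw : ZigLast (Y ++ c :: x :: X) w) :
    FlipReach D (X.length + Y.length + 2) ([ξ, c'] ++ w)
      ([ξ, c'] ++ (X.reverse ++ (Y ++ [x, c]))) := by
  have hstraight := hw.reverse_left.flipReach h.reverse
  have hself := h _ (zig_reverse _)
  have hturned := h (X.reverse ++ (Y ++ [c, x])) (by simpa using (zig_self (Y ++ [c, x])).append X)
  have hswapped := h (X.reverse ++ (Y ++ [x, c]))
    (by simpa using ((zig_reverse [c, x]).prepend Y).append X)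
  have hturn := PlaneListIn.reverse_suffix (p₁ := [ξ, c'] ++ X.reverse)
    (p₂ := (Y ++ [c, x]).reverse) (by simpa using hself) (by simpa using hturned)
  have hswap := PlaneListIn.reverse_suffix (p₁ := [ξ, c'] ++ X.reverse ++ Y)
    (p₂ := [c, x]) (by simpa using hturned) (by simpa using hswapped)
  simp only [List.reverse_reverse] at hturn
  refine ((hstraight.trans (by simpa using hturn)).trans (by simpa using hswap)).mono ?_
  simp only [List.length_reverse, List.length_append, List.length_cons]
  lia

lemma AllZigs.flipReach_of_head_of_last (h : AllZigs D [ξ, c] (X ++ c' :: Y))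
    (h' : AllZigs D [ξ, c'] (Y ++ c :: X)) (hX : X ≠ []) (hw : ZigHead (X ++ c' :: Y) w)
    (hw' : ZigLast (Y ++ c :: X) w') :
    FlipReach D (2 * (X.length + Y.length) + 1) ([ξ, c] ++ w) ([ξ, c'] ++ w') := by
  obtain ⟨x, X, rfl⟩ := List.exists_cons_of_ne_nil hX
  obtain ⟨x', l, v, e, rfl, hv⟩ := hw
  obtain ⟨rfl, rfl⟩ := List.cons_eq_cons.1 e
  have htail : AllZigs D [ξ, c, x] (X ++ c' :: Y) := h.tail
  by_cases hpivot : X = [] ∨ ZigHead (X ++ c' :: Y) v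
  · have hT := hv.flipReach_pivot htail (hpivot.imp_right .inr)
    refine (h.flipReach_of_pivots h' hT (hw'.zig.flipReach_pivot_succ h')).mono ?_
    rw [List.length_cons]
    lia
  · rw [not_or] at hpivot
    have hlast : ZigLast (X ++ c' :: Y) v :=
      (hv.eq_nil_or_zigHead_or_zigLast.resolve_left (by simp)).resolve_left hpivot.2
    have hT := h.flipReach_zigzag_left hlast hpivot.1
    have hT' := h'.flipReach_zigzag_right hw'
    have hp := htail (Y.reverse ++ (X ++ [c']))
      (by simpa using (zig_self (X ++ [c'])).append Y)
    have hp' := h' (X.reverse ++ (Y ++ [x, c]))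
      (by simpa using ((zig_reverse [c, x]).prepend Y).append X)
    have hrev : [ξ, c'] ++ (X.reverse ++ (Y ++ [x, c])) =
        ξ :: (c :: x :: (Y.reverse ++ (X ++ [c']))).reverse := by simp
    rw [hrev] at hp' hT'
    refine (hp.flipReach_of_reverse hp' hT hT').mono ?_
    rw [List.length_cons]
    lia

lemma AllZigs.flipReach_of_zig (h : AllZigs D [ξ, c] (X ++ c' :: Y))
    (h' : AllZigs D [ξ, c'] (Y ++ c :: X)) (hw : Zig (X ++ c' :: Y) w)
    (hw' : Zig (Y ++ c :: X) w') :
    FlipReach D (2 * (X.length + Y.length) + 1) ([ξ, c] ++ w) ([ξ, c'] ++ w') := by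
  by_cases hXY : X = [] ∨ Y = []
  · exact (h.flipReach_of_pivots h' (hw.flipReach_pivot h (hXY.imp_right .inl))
      (hw'.flipReach_pivot h' (hXY.symm.imp_right .inl))).mono (by lia)
  obtain ⟨hX, hY⟩ := not_or.1 hXY
  rcases hw.eq_nil_or_zigHead_or_zigLast.resolve_left (by simp) with hhead | hlast <;>
    rcases hw'.eq_nil_or_zigHead_or_zigLast.resolve_left (by simp) with hhead' | hlast'
  · exact (h.flipReach_of_pivots h' (hw.flipReach_pivot h (.inr (.inr hhead)))
      (hw'.flipReach_pivot h' (.inr (.inr hhead')))).mono (by lia)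
  · exact h.flipReach_of_head_of_last h' hX hhead hlast'
  · exact (h'.flipReach_of_head_of_last h hY hhead' hlast).symm.mono (by lia)
  · have hr : AllZigs D [ξ, c] (Y.reverse ++ c' :: X.reverse) := by simpa using h.reverse
    have hr' : AllZigs D [ξ, c'] (X.reverse ++ c :: Y.reverse) := by simpa using h'.reverse
    have hhead : ZigHead (Y.reverse ++ c' :: X.reverse) w := by simpa using hlast.reverse_left
    have hhead' : ZigHead (X.reverse ++ c :: Y.reverse) w' := by simpa using hlast'.reverse_left
    refine (hr.flipReach_of_pivots hr' (hhead.zig.flipReach_pivot hr (.inr (.inr hhead)))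
      (hhead'.zig.flipReach_pivot hr' (.inr (.inr hhead')))).mono ?_
    rw [List.length_reverse, List.length_reverse]
    lia

end Pivot

section EndPaths

variable {C : Set Plane} {ξ b c c' x : Plane} {D : Set (PlanePath (insert ξ C))}
  {l w w' : List Plane}

lemma OuterPoint.exists_seesPast_ne (h : OuterPoint C ξ) (hb : b ∈ C) (hbc : b ≠ c) :
    ∃ d ∈ C, d ≠ c ∧ SeesPast ξ C d := by
  by_cases hall : ∀ a ∈ C, SeesPast ξ C a
  · exact ⟨b, hb, hbc, hall b hb⟩
  push Not at hall
  obtain ⟨a, haC, ha⟩ := hall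
  obtain ⟨l, hl⟩ := h.exists_hull_cons haC
  obtain ⟨R, L, rfl, hs⟩ := h.exists_isSplit hl ha
  obtain ⟨R, u, rfl⟩ := (List.eq_nil_or_concat' R).resolve_left hs.left_ne
  obtain ⟨v, L, rfl⟩ := List.exists_cons_of_ne_nil hs.right_ne
  have huv : u ≠ v := by
    rintro rfl
    exact List.disjoint_of_nodup_append hl.nodup.of_cons (by simp) List.mem_cons_self
  have hu : HeadVisible C ξ (u :: R.reverse) := by simpa using hs.last_visible
  rcases eq_or_ne u c with rfl | huc
  · exact ⟨v, (hl.mem_iff v).1 (by simp), huv.symm, headVisible_cons.1 hs.head_visible⟩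
  · exact ⟨u, (hl.mem_iff u).1 (by simp), huc, headVisible_cons.1 hu⟩

lemma OuterPoint.seesPast_of_end (h : OuterPoint C ξ)
    (hp : PlaneList (insert ξ C) (join ξ [] (c :: w))) : SeesPast ξ C c := by
  by_contra hc
  obtain ⟨R, L, -, hs, -, hL⟩ := h.exists_sides hp.join_comm hc
  exact hs.right_ne hL.nil_eq.symm

lemma PlaneList.zig_of_end (hξ : ξ ∉ C) (hp : PlaneList (insert ξ C) (join ξ [] (c :: w)))
    (hl : IsHull C (c :: l)) : Zig l w :=
  NonCrossing.zig hp.nonCrossing.of_cons (hp.append_perm hξ hl).cons_inv hl.cyclic hl.nodup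

/-- Every plane path ending in `ξ` belongs to `D`. -/
def AdmitsOuter (D : Set (PlanePath (insert ξ C))) : Prop :=
  ∀ B, B ≠ [] → PlaneList (insert ξ C) (join ξ [] B) → PlaneListIn D (join ξ [] B)

lemma AdmitsOuter.allZigs (hD : AdmitsOuter D) (hξ : ξ ∉ C) (hl : IsHull C (c :: l))
    (hc : SeesPast ξ C c) : AllZigs D [ξ, c] l := by
  refine fun w hw => hD (c :: w) (by simp) (planeList_join (I := []) hξ hl (pathOn_self [])
    (pathOn_cons_iff.2 ⟨[], l, rfl, by simpa using hw⟩) fun a ha => ?_)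
  obtain rfl : c = a := by simpa using ha
  exact ⟨hc.mono (by simp), hc.mono fun x => (hl.mem_iff x).1⟩

lemma OuterPoint.reachesDetour_of_end (h : OuterPoint C ξ) (hI : AdmitsInner D)
    (hO : AdmitsOuter D) (hp : PlaneList (insert ξ C) (join ξ [] (c :: x :: w))) :
    ReachesDetour D (w.length + 1) (join ξ [] (c :: x :: w)) := by
  have hc := h.seesPast_of_end hp
  have hcC : c ∈ C := (hp.mem_append_iff h.notMem).1 (by simp)
  have hxC : x ∈ C := (hp.mem_append_iff h.notMem).1 (by simp)
  have hxc : x ≠ c := by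
    rintro rfl
    exact hp.nodup_append.notMem List.mem_cons_self
  obtain ⟨b, hbC, hbc, hb⟩ := h.exists_seesPast_ne hxC hxc
  obtain ⟨X, Y, hl, hX⟩ := h.exists_visible_arc hcC hbC hbc.symm hc hb
  have hd : HullDetour C ξ [c] (X ++ b :: Y) :=
    { hull := IsHull.rotate (l₁ := [c]) hl
      left_ne := by simp
      right_ne := by simp
      head_visible := by
        simpa using (HeadVisible.of_forall hX).append fun _ => headVisible_cons.2 hb
      last_visible := by simpa using headVisible_cons.2 hc }
  have hz := hp.zig_of_end h.notMem hl
  have hzigs := hO.allZigs h.notMem hl hc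
  have hflip := (hzigs _ (zig_self _)).flip (q₁ := [c, ξ]) (q₂ := X ++ b :: Y)
    (hd.planeListIn_self hI h.notMem) (.inr rfl) (.inl rfl)
  have hlen := hz.perm.length_eq
  refine ⟨_, _, hd, ((hz.flipReach hzigs).1.trans hflip).mono ?_⟩
  rw [← hlen, List.length_cons]
  lia

lemma OuterPoint.flipReach_of_end (h : OuterPoint C ξ) (hD : AdmitsOuter D)
    (hp : PlaneList (insert ξ C) (join ξ [] (c :: w)))
    (hp' : PlaneList (insert ξ C) (join ξ [] (c' :: w'))) :
    FlipReach D (2 * w.length - 1) (join ξ [] (c :: w)) (join ξ [] (c' :: w')) := by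
  have hc := h.seesPast_of_end hp
  have hc' := h.seesPast_of_end hp'
  have hcC : c ∈ C := (hp.mem_append_iff h.notMem).1 (by simp)
  have hcC' : c' ∈ C := (hp'.mem_append_iff h.notMem).1 (by simp)
  rcases eq_or_ne c c' with rfl | hcc
  · obtain ⟨l, hl⟩ := h.exists_hull_cons hcC
    have hz := hp.zig_of_end h.notMem hl
    have hz' := hp'.zig_of_end h.notMem hl
    have hzigs := hD.allZigs h.notMem hl hc
    have hlen := hz.perm.length_eq
    exact ((hz.flipReach hzigs).1.trans (hz'.flipReach hzigs).1.symm).mono (by lia)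
  · obtain ⟨X, Y, hl, -⟩ := h.exists_visible_arc hcC hcC' hcc hc hc'
    have hl' : IsHull C (c' :: Y ++ c :: X) := hl.rotate
    have hz : Zig (X ++ c' :: Y) w := hp.zig_of_end h.notMem hl
    have hlen := hz.perm.length_eq
    rw [List.length_append, List.length_cons] at hlen
    exact ((hD.allZigs h.notMem hl hc).flipReach_of_zig (hD.allZigs h.notMem hl' hc') hz
      (hp'.zig_of_end h.notMem hl')).mono (by lia)

end EndPaths

section Diameter

variable {V W : Type*} {G : SimpleGraph V} {H : SimpleGraph W}

lemma edist_map_le (f : G →g H) (u v : V) : H.edist (f u) (f v) ≤ G.edist u v := by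
  by_cases huv : G.edist u v = ⊤
  · exact huv ▸ le_top
  · obtain ⟨p, hp⟩ := SimpleGraph.exists_walk_of_edist_ne_top huv
    simpa [← hp] using SimpleGraph.edist_le (p.map f)

lemma ediam_le_of_iso (e : G ≃g H) : H.ediam ≤ G.ediam := by
  refine SimpleGraph.ediam_le_of_edist_le fun u v => ?_
  simpa using (edist_map_le e.toHom (e.symm u) (e.symm v)).trans SimpleGraph.edist_le_ediam

lemma connected_and_ediam_le [Nonempty V] {k : ℕ} (h : ∀ u v, G.edist u v ≤ k) :
    G.Connected ∧ G.ediam ≤ k :=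
  have hd := SimpleGraph.ediam_le_of_edist_le h
  ⟨SimpleGraph.connected_of_ediam_ne_top (ne_top_of_le_ne_top (ENat.natCast_ne_top k) hd), hd⟩

lemma connected_and_ediam_le_of_iso {d : ℕ∞} (e : G ≃g H) (h : G.Connected ∧ G.ediam ≤ d) :
    H.Connected ∧ H.ediam ≤ d :=
  ⟨e.connected_iff.1 h.1, (ediam_le_of_iso e).trans h.2⟩

end Diameter

section InducedFlipGraph

variable {S C : Set Plane} {ξ : Plane} {k : ℕ} {p q A B : List Plane}

lemma FlipReach.edist_le {D : Set (PlanePath S)} {P Q : D} (h : FlipReach D k p q)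
    (hP : P.1.1 = pathOf S p) (hQ : Q.1.1 = pathOf S q) :
    ((flipGraph S).induce D).edist P Q ≤ k := by
  obtain ⟨P', Q', hP', hQ', hk⟩ := h
  obtain rfl : P' = P := Subtype.ext (Subtype.ext (hP'.trans hP.symm))
  obtain rfl : Q' = Q := Subtype.ext (Subtype.ext (hQ'.trans hQ.symm))
  exact hk

lemma PlaneList.planeListIn {D : Set (PlanePath S)} (hp : PlaneList S p)
    (hS : InGeneralPosition S) (hD : ∀ P : PlanePath S, P.1 = pathOf S p → P ∈ D) :
    PlaneListIn D p :=
  let P : PlanePath S := ⟨pathOf S p, isSpanningPath_pathOf hp.nodup hp.mem_iff, hp.isPlane hS⟩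
  ⟨hp, ⟨P, hD P rfl⟩, rfl⟩

lemma PlaneList.length_join (hξ : ξ ∉ C) (hp : PlaneList (insert ξ C) (join ξ A B)) :
    A.length + B.length = C.ncard := by
  classical
  have hC : C = (A ++ B).toFinset :=
    Set.ext fun x => by rw [← hp.mem_append_iff hξ, Finset.mem_coe, List.mem_toFinset]
  rw [hC, Set.ncard_coe_finset, List.toFinset_card_of_nodup hp.nodup_append, List.length_append]

lemma exists_eq_pathOf_join (hC : C.Nonempty) (hξ : ξ ∉ C) (P : PlanePath (insert ξ C)) :
    ∃ A B, B ≠ [] ∧ PlaneList (insert ξ C) (join ξ A B) ∧ P.1 = pathOf _ (join ξ A B) := by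
  obtain ⟨p, hp, hP⟩ := exists_planeList P
  obtain ⟨A, B, rfl⟩ := List.append_of_mem ((hp.mem_iff ξ).2 (Set.mem_insert ξ C))
  rw [← join_reverse_left_eq] at hp hP
  rcases eq_or_ne B [] with rfl | hB
  · refine ⟨[], A.reverse, ?_, hp.join_comm, by rw [hP, ← pathOf_reverse, join_reverse]⟩
    rintro hA
    obtain ⟨x, hx⟩ := hC
    simpa [hA] using (hp.mem_append_iff hξ).2 hx
  · exact ⟨A.reverse, B, hB, hp, hP⟩

lemma admitsInner_univ (hS : InGeneralPosition (insert ξ C)) :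
    AdmitsInner (Set.univ : Set (PlanePath (insert ξ C))) :=
  fun _ _ _ _ hp => hp.planeListIn hS fun _ _ => Set.mem_univ _

lemma admitsOuter_univ (hS : InGeneralPosition (insert ξ C)) :
    AdmitsOuter (Set.univ : Set (PlanePath (insert ξ C))) :=
  fun _ _ hp => hp.planeListIn hS fun _ _ => Set.mem_univ _

lemma admitsInner_pathsWithDegree (hS : InGeneralPosition (insert ξ C)) :
    AdmitsInner (pathsWithDegree (insert ξ C) ⟨ξ, Set.mem_insert ξ C⟩ 2) :=
  fun _ _ hA hB hp => hp.planeListIn hS fun P hP => by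
    rw [pathsWithDegree, Set.mem_ofPred_eq, hP, ncard_neighborSet_of_ne_nil _ hp hA hB]

lemma admitsOuter_pathsWithDegree (hS : InGeneralPosition (insert ξ C)) :
    AdmitsOuter (pathsWithDegree (insert ξ C) ⟨ξ, Set.mem_insert ξ C⟩ 1) :=
  fun _ hB hp => hp.planeListIn hS fun P hP => by
    rw [pathsWithDegree, Set.mem_ofPred_eq, hP, ncard_neighborSet_of_nil _ hp hB]

variable {D : Set (PlanePath (insert ξ C))}

lemma OuterPoint.exists_visible_hull (h : OuterPoint C ξ) (hC : 1 < C.ncard) :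
    ∃ a X b Y, IsHull C (a :: X ++ b :: Y) ∧ SeesPast ξ C a ∧ SeesPast ξ C b := by
  obtain ⟨x, hx, y, hy, hxy⟩ := (Set.one_lt_ncard h.finite).1 hC
  obtain ⟨a, haC, hax, ha⟩ := h.exists_seesPast_ne hy hxy.symm
  obtain ⟨b, hbC, hba, hb⟩ := h.exists_seesPast_ne hx hax.symm
  obtain ⟨X, Y, hl, -⟩ := h.exists_visible_arc haC hbC hba.symm ha hb
  exact ⟨a, X, b, Y, hl, ha, hb⟩

lemma AdmitsInner.nonempty (hD : AdmitsInner D) (h : OuterPoint C ξ) (hC : 1 < C.ncard) :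
    Nonempty D := by
  obtain ⟨a, X, b, Y, hl, ha, hb⟩ := h.exists_visible_hull hC
  have hp := hD.planeListIn h.notMem hl (pathOn_self _) (pathOn_self _) (by simp) (by simp)
    (headVisible_cons.2 ha) (headVisible_cons.2 hb)
  exact hp.exists_path.nonempty

lemma AdmitsOuter.nonempty (hD : AdmitsOuter D) (h : OuterPoint C ξ) (hC : 1 < C.ncard) :
    Nonempty D := by
  obtain ⟨a, X, b, Y, hl, ha, -⟩ := h.exists_visible_hull hC
  exact (hD.allZigs h.notMem hl ha _ (zig_self _)).exists_path.nonempty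

lemma OuterPoint.connected_and_ediam_le_of_reachesDetour (h : OuterPoint C ξ)
    (hD : AdmitsInner D) (hC : 1 < C.ncard)
    (hdetour : ∀ P ∈ D, ∃ p, P.1 = pathOf _ p ∧ ReachesDetour D k p) :
    ((flipGraph (insert ξ C)).induce D).Connected ∧
      ((flipGraph (insert ξ C)).induce D).ediam ≤ (2 * k + 4 : ℕ) := by
  have := hD.nonempty h hC
  refine connected_and_ediam_le fun P Q => ?_
  obtain ⟨p, hP, P₁, P₂, hd, hp⟩ := hdetour P P.2
  obtain ⟨q, hQ, Q₁, Q₂, hd', hq⟩ := hdetour Q Q.2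
  exact (((hp.trans (hd.flipReach hd' hD h.notMem)).trans hq.symm).mono (by lia)).edist_le hP hQ

lemma OuterPoint.reachesDetour_of_ne_nil (h : OuterPoint C ξ) (hD : AdmitsInner D)
    (hA : A ≠ []) (hB : B ≠ []) (hp : PlaneList (insert ξ C) (join ξ A B)) :
    ReachesDetour D (C.ncard - 1) (join ξ A B) := by
  obtain ⟨a, w, rfl⟩ := List.exists_cons_of_ne_nil hA
  obtain ⟨b, w', rfl⟩ := List.exists_cons_of_ne_nil hB
  have hlen := hp.length_join h.notMem
  simp only [List.length_cons] at hlen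
  exact (h.reachesDetour hD hp).mono (by lia)

lemma OuterPoint.reachesDetour_of_nil (h : OuterPoint C ξ) (hI : AdmitsInner D)
    (hO : AdmitsOuter D) (hC : 1 < C.ncard) (hp : PlaneList (insert ξ C) (join ξ [] B)) :
    ReachesDetour D (C.ncard - 1) (join ξ [] B) := by
  have hlen := hp.length_join h.notMem
  obtain ⟨c, x, w, rfl⟩ : ∃ c x w, B = c :: x :: w := by
    rcases B with _ | ⟨c, _ | ⟨x, w⟩⟩
    · simp at hlen; lia
    · simp at hlen; lia
    · exact ⟨c, x, w, rfl⟩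
  simp only [List.length_nil, List.length_cons] at hlen
  exact (h.reachesDetour_of_end hI hO hp).mono (by lia)

theorem OuterPoint.connected_and_ediam_le_flipGraph (h : OuterPoint C ξ) (hC : 1 < C.ncard) :
    (flipGraph (insert ξ C)).Connected ∧
      (flipGraph (insert ξ C)).ediam ≤ (2 * (C.ncard - 1) + 4 : ℕ) := by
  have hI := admitsInner_univ h.general
  have hO := admitsOuter_univ h.general
  refine connected_and_ediam_le_of_iso (SimpleGraph.induceUnivIso _)
    (h.connected_and_ediam_le_of_reachesDetour hI hC fun P _ => ?_)
  obtain ⟨A, B, hB, hp, hP⟩ :=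
    exists_eq_pathOf_join (Set.nonempty_of_ncard_ne_zero (by lia)) h.notMem P
  rcases eq_or_ne A [] with rfl | hA
  · exact ⟨_, hP, h.reachesDetour_of_nil hI hO hC hp⟩
  · exact ⟨_, hP, h.reachesDetour_of_ne_nil hI hA hB hp⟩

theorem OuterPoint.connected_and_ediam_le_degree_one (h : OuterPoint C ξ) (hC : 1 < C.ncard) :
    ((flipGraph (insert ξ C)).induce
      (pathsWithDegree (insert ξ C) ⟨ξ, Set.mem_insert ξ C⟩ 1)).Connected ∧
    ((flipGraph (insert ξ C)).induce
      (pathsWithDegree (insert ξ C) ⟨ξ, Set.mem_insert ξ C⟩ 1)).ediam ≤ (2 * C.ncard - 3 : ℕ) := by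
  have hO := admitsOuter_pathsWithDegree h.general
  have hend (P : PlanePath (insert ξ C))
      (hP : P ∈ pathsWithDegree (insert ξ C) ⟨ξ, Set.mem_insert ξ C⟩ 1) :
      ∃ c w, PlaneList (insert ξ C) (join ξ [] (c :: w)) ∧
        P.1 = pathOf _ (join ξ [] (c :: w)) := by
    obtain ⟨A, B, hB, hp, hPp⟩ :=
      exists_eq_pathOf_join (Set.nonempty_of_ncard_ne_zero (by lia)) h.notMem P
    rcases eq_or_ne A [] with rfl | hA
    · obtain ⟨c, w, rfl⟩ := List.exists_cons_of_ne_nil hB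
      exact ⟨c, w, hp, hPp⟩
    · rw [pathsWithDegree, Set.mem_ofPred_eq, hPp, ncard_neighborSet_of_ne_nil _ hp hA hB] at hP
      lia
  have := hO.nonempty h hC
  refine connected_and_ediam_le fun P Q => ?_
  obtain ⟨c, w, hp, hP⟩ := hend P P.2
  obtain ⟨c', w', hq, hQ⟩ := hend Q Q.2
  have hlen := hp.length_join h.notMem
  simp only [List.length_nil, List.length_cons] at hlen
  exact ((h.flipReach_of_end hO hp hq).mono (by lia)).edist_le hP hQ

theorem OuterPoint.connected_and_ediam_le_degree_two (h : OuterPoint C ξ) (hC : 1 < C.ncard) :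
    ((flipGraph (insert ξ C)).induce
      (pathsWithDegree (insert ξ C) ⟨ξ, Set.mem_insert ξ C⟩ 2)).Connected ∧
    ((flipGraph (insert ξ C)).induce
      (pathsWithDegree (insert ξ C) ⟨ξ, Set.mem_insert ξ C⟩ 2)).ediam ≤
        (2 * (C.ncard - 1) + 4 : ℕ) := by
  have hI := admitsInner_pathsWithDegree h.general
  refine h.connected_and_ediam_le_of_reachesDetour hI hC fun P hPd => ?_
  obtain ⟨A, B, hB, hp, hP⟩ :=
    exists_eq_pathOf_join (Set.nonempty_of_ncard_ne_zero (by lia)) h.notMem P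
  refine ⟨_, hP, h.reachesDetour_of_ne_nil hI ?_ hB hp⟩
  rintro rfl
  rw [pathsWithDegree, Set.mem_ofPred_eq, hP, ncard_neighborSet_of_nil _ hp hB] at hPd
  lia

end InducedFlipGraph

end PlanePaths

theorem theorem1_general (n : ℕ) (hn : 3 ≤ n) (C : Set Plane) (ξ : Plane)
    (hfin : C.Finite) (hcard : C.ncard = n - 1)
    (hconv : InConvexPosition C) (hξ : ξ ∉ convexHull ℝ C)
    (hgen : InGeneralPosition (insert ξ C)) :
    ((flipGraph (insert ξ C)).Connected ∧
      (flipGraph (insert ξ C)).ediam ≤ ((2 * n : ℕ) : ℕ∞)) ∧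
    (((flipGraph (insert ξ C)).induce
        (pathsWithDegree (insert ξ C) ⟨ξ, Set.mem_insert ξ C⟩ 1)).Connected ∧
      ((flipGraph (insert ξ C)).induce
        (pathsWithDegree (insert ξ C) ⟨ξ, Set.mem_insert ξ C⟩ 1)).ediam
          ≤ ((2 * n - 5 : ℕ) : ℕ∞)) ∧
    (((flipGraph (insert ξ C)).induce
        (pathsWithDegree (insert ξ C) ⟨ξ, Set.mem_insert ξ C⟩ 2)).Connected ∧
      ((flipGraph (insert ξ C)).induce
        (pathsWithDegree (insert ξ C) ⟨ξ, Set.mem_insert ξ C⟩ 2)).ediam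
          ≤ ((2 * n : ℕ) : ℕ∞)) := by
  have h : PlanePaths.OuterPoint C ξ := ⟨hfin, hconv, hξ, hgen⟩
  have hC : 1 < C.ncard := by lia
  have hdetour : 2 * (C.ncard - 1) + 4 = 2 * n := by lia
  have hend : 2 * C.ncard - 3 = 2 * n - 5 := by lia
  exact ⟨hdetour ▸ h.connected_and_ediam_le_flipGraph hC,
    hend ▸ h.connected_and_ediam_le_degree_one hC,
    hdetour ▸ h.connected_and_ediam_le_degree_two hC⟩

theorem theorem1 (n : ℕ) (hn : 3 ≤ n) (C : Set Plane) (ξ : Plane)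
    (hfin : C.Finite) (hcard : C.ncard = n - 1)
    (hconv : InConvexPosition C) (hξ : ξ ∉ convexHull ℝ C)
    (hgen : InGeneralPosition (insert ξ C)) :
    ((flipGraph (insert ξ C)).Connected ∧
      (flipGraph (insert ξ C)).ediam ≤ ((2 * n : ℕ) : ℕ∞)) ∧
    (((flipGraph (insert ξ C)).induce
        (pathsWithDegree (insert ξ C) ⟨ξ, Set.mem_insert ξ C⟩ 1)).Connected ∧
      (5 ≤ n →
        ((flipGraph (insert ξ C)).induce
          (pathsWithDegree (insert ξ C) ⟨ξ, Set.mem_insert ξ C⟩ 1)).ediam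
            ≤ ((4 * n - 15 : ℕ) : ℕ∞))) ∧
    (((flipGraph (insert ξ C)).induce
        (pathsWithDegree (insert ξ C) ⟨ξ, Set.mem_insert ξ C⟩ 2)).Connected ∧
      ((flipGraph (insert ξ C)).induce
        (pathsWithDegree (insert ξ C) ⟨ξ, Set.mem_insert ξ C⟩ 2)).ediam
          ≤ ((2 * n : ℕ) : ℕ∞)) := by
  obtain ⟨ha, ⟨hb, hb'⟩, hc⟩ := theorem1_general n hn C ξ hfin hcard hconv hξ hgen
  exact ⟨ha, ⟨hb, fun _ => hb'.trans (mod_cast by lia)⟩, hc⟩
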